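/- \textbf{Setting.} Let $0\le k<n$ and let $(M,\omega)$ be a smooth (Hausdorff) symplectic manifold of dimension $2n$; let $J:T_m^*M\to T_mM$ be the isomorphism given by $\omega(x,Ja)=a(x)$. Let $F_1,\dots,F_k:M\to\mathbb R$ be smooth functions in involution, $\omega(JdF_i,JdF_j)=0$, whose differentials are linearly independent at every point, and assume that the Hamiltonian flows $g_j^t$ of $\dot x=JdF_j(x)$ are defined for all $t\in\mathbb R$. Let $\Lambda\subset M$ be a smoothly embedded isotropic $k$-dimensional torus with $g_j^t(\Lambda)=\Lambda$ for all $j$ and $t$. Write $[\cdot,\cdot]$ for the complex bilinear extension of $\omega$ to $T_mM^{\mathbb C}=\mathbb C\otimes T_mM$, and use the same symbol for complexifications of linear maps. A \emph{complex germ} on $\Lambda$ invariant under the flows is a family of complex subspaces $r(m)\subset T_mM^{\mathbb C}$, $m\in\Lambda$, depending smoothly on $m$, such that (i) $r(m)$ is Lagrangian: $\dim_{\mathbb C}r(m)=n$ and $[x,y]=0$ for $x,y\in r(m)$; (ii) $T_m\Lambda^{\mathbb C}\subset r(m)$; (iii) $\frac1{2i}[x,\bar x]>0$ for every $x\in r(m)\setminus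 T_m\Lambda^{\mathbb C}$; (iv) $(g_j^t)_{*,m}(r(m))=r(g_j^t m)$ for all $j$, $t\in\mathbb R$ and $m\in\Lambda$. For $m\in\Lambda$ let $T_m\Sigma=\bigcap_j\ker dF_j(m)$ be the tangent space of the joint level set of $F_1,\dots,F_k$ through $m$, let $\Gamma_m=T_m\Sigma/T_m\Lambda$, and let $\Pi:T_m\Sigma\to\Gamma_m$ be the projection. For $t\in\mathbb R^k$ put $g^t=g_1^{t_1}\circ\dots\circ g_k^{t_k}$, and let $G=\{T\in\mathbb R^k: g^Tm=m\}$ be the group of periods. For $T\in G$ the \emph{reduced monodromy operator} $\Xi_T:\Gamma_m\to\Gamma_m$ is induced by $g^T_{*,m}:T_mM\to T_mM$, that is, $\Xi_T[\theta]=[g^T_{*,m}\theta]$; for generators $T_1,\dots,T_k$ of $G$ one writes $\Xi_j=\Xi_{T_j}$. A linear operator $S$ on a finite-dimensional space is \emph{stable} if for every $\varepsilon>0$ there is $\delta>0$ such that $|x|<\delta$ implies $|S^\nu x|<\varepsilon$ for all integers $\nu>0$ (in any norm). \textbf{Theorem.} Suppose that a complex germ $r$ on $\Lambda$ invariant under the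 flows $g_1^t,\dots,g_k^t$ exists. Then for every $m\in\Lambda$ the following holds. The form $\omega$ induces a well-defined non-degenerate form on $\Gamma_m$, given by $\omega([\theta],[\theta'])=\omega(\theta,\theta')$. The subspace $R=\Pi(r(m)\cap T_m\Sigma^{\mathbb C})\subset\Gamma_m^{\mathbb C}$ is Lagrangian, that is, isotropic with $\dim_{\mathbb C}R=\frac12\dim\Gamma_m$, and positive, that is, $\frac1{2i}[x,\bar x]>0$ for $0\neq x\in R$. For every $T\in G$ the operator $\Xi_T$ is well defined, $\Xi_T(R)=R$, and $\Xi_T$ is stable, both on $\Gamma_m$ and on $\Gamma_m^{\mathbb C}$. In particular, $R$ is a common positive Lagrangian invariant subspace of the reduced monodromy operators $\Xi_1,\dots,\Xi_k$, and all of them are stable. -/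

import Mathlib

open scoped Manifold ContDiff TensorProduct Topology

noncomputable section

namespace ComplexGerm

/-! ### Linear algebra: complexification, Lagrangian and positive subspaces, stability -/

section Linear

/-- Complex conjugation `x + iy ↦ x - iy` on the complexification `ℂ ⊗ V` of a real space `V`. -/
def conj (V : Type*) [AddCommGroup V] [Module ℝ V] : (ℂ ⊗[ℝ] V) →ₗ[ℝ] (ℂ ⊗[ℝ] V) :=
  TensorProduct.map Complex.conjAe.toLinearMap LinearMap.id

/-- A complex subspace `L` of `ℂ ⊗ V` is Lagrangian for the complexification of `B` if it is
isotropic and its complex dimension is half of the dimension of `V`. -/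
def IsLagrangian {V : Type*} [AddCommGroup V] [Module ℝ V] (B : LinearMap.BilinForm ℝ V)
    (L : Submodule ℂ (ℂ ⊗[ℝ] V)) : Prop :=
  (∀ x ∈ L, ∀ y ∈ L, B.baseChange ℂ x y = 0) ∧ 2 * Module.finrank ℂ L = Module.finrank ℝ V

/-- The number `(1/2i)[x, x̄]`, where `[ , ]` is the complexification of `B`. For antisymmetric `B`
it is real, so that nothing is lost by taking the real part. -/
def hermitianValue {V : Type*} [AddCommGroup V] [Module ℝ V] (B : LinearMap.BilinForm ℝ V)
    (x : ℂ ⊗[ℝ] V) : ℝ :=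
  (1 / (2 * Complex.I) * B.baseChange ℂ x (conj V x)).re

/-- A complex subspace `R` of `ℂ ⊗ V` is positive if `(1/2i)[x, x̄] > 0` for `0 ≠ x ∈ R`. -/
def IsPositive {V : Type*} [AddCommGroup V] [Module ℝ V] (B : LinearMap.BilinForm ℝ V)
    (R : Submodule ℂ (ℂ ⊗[ℝ] V)) : Prop :=
  ∀ x ∈ R, x ≠ 0 → 0 < hermitianValue B x

/-- A complex subspace `L` of `ℂ ⊗ V` is dissipative with respect to `N ⊆ V` if
`(1/2i)[x, x̄] > 0` for all `x` in `L` outside the complexification of `N`. -/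
def IsDissipative {V : Type*} [AddCommGroup V] [Module ℝ V] (B : LinearMap.BilinForm ℝ V)
    (N : Submodule ℝ V) (L : Submodule ℂ (ℂ ⊗[ℝ] V)) : Prop :=
  ∀ x ∈ L, x ∉ N.baseChange ℂ → 0 < hermitianValue B x

/-- An operator `S` on a finite-dimensional space is stable if for every norm on the space and every
`ε > 0` there is `δ > 0` such that `|x| < δ` implies `|Sⁿ x| < ε` for all `n > 0`.
(All norms are equivalent, so the quantifier over the norms may be read as "all" or as "some".) -/
def IsStable {𝕜 V : Type*} [RCLike 𝕜] [AddCommGroup V] [Module 𝕜 V] (S : V →ₗ[𝕜] V) : Prop :=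
  ∀ N : Seminorm 𝕜 V, (∀ x, N x = 0 → x = 0) →
    ∀ ε : ℝ, 0 < ε → ∃ δ : ℝ, 0 < δ ∧ ∀ x, N x < δ → ∀ n : ℕ, 0 < n → N ((S ^ n) x) < ε

end Linear

/-! ### Symplectic manifolds and Hamiltonian flows -/

section Symplectic

/-- The components, in the chart at `x₀`, of a field of bilinear forms on the tangent spaces: the
function `y ↦ Ω (u, v)` on the target of the chart, where the constant vectors `u, v` are carried to
the manifold by the derivative of the inverse chart. -/
def formInChart {n : ℕ} {M : Type*} [TopologicalSpace M]
    [ChartedSpace (EuclideanSpace ℝ (Fin (2 * n))) M]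
    (Ω : ∀ m : M, LinearMap.BilinForm ℝ (TangentSpace (𝓡 (2 * n)) m)) (x₀ : M)
    (u v : EuclideanSpace ℝ (Fin (2 * n))) (y : EuclideanSpace ℝ (Fin (2 * n))) : ℝ :=
  Ω ((extChartAt (𝓡 (2 * n)) x₀).symm y)
    (mfderiv 𝓘(ℝ, EuclideanSpace ℝ (Fin (2 * n))) (𝓡 (2 * n))
      (extChartAt (𝓡 (2 * n)) x₀).symm y u)
    (mfderiv 𝓘(ℝ, EuclideanSpace ℝ (Fin (2 * n))) (𝓡 (2 * n))
      (extChartAt (𝓡 (2 * n)) x₀).symm y v)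

/-- A symplectic structure on a `2n`-dimensional manifold: a smooth, closed, non-degenerate 2-form.
Smoothness and closedness (`dΩ = 0`, the cyclic sum of the derivatives of the components) are
expressed in the charts. -/
structure SymplecticForm (n : ℕ) (M : Type*) [TopologicalSpace M]
    [ChartedSpace (EuclideanSpace ℝ (Fin (2 * n))) M] where
  form : ∀ m : M, LinearMap.BilinForm ℝ (TangentSpace (𝓡 (2 * n)) m)
  antisymm : ∀ (m : M) (x y : TangentSpace (𝓡 (2 * n)) m), form m x y = -form m y x
  nondegenerate : ∀ (m : M) (y : TangentSpace (𝓡 (2 * n)) m), (∀ x, form m x y = 0) → y = 0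
  smooth : ∀ (x₀ : M) (u v : EuclideanSpace ℝ (Fin (2 * n))),
    ContDiffOn ℝ ∞ (formInChart form x₀ u v) (extChartAt (𝓡 (2 * n)) x₀).target
  closed : ∀ (x₀ : M), ∀ y ∈ (extChartAt (𝓡 (2 * n)) x₀).target,
    ∀ u v w : EuclideanSpace ℝ (Fin (2 * n)),
      fderiv ℝ (formInChart form x₀ v w) y u + fderiv ℝ (formInChart form x₀ w u) y v
        + fderiv ℝ (formInChart form x₀ u v) y w = 0

variable {n : ℕ} {M : Type*} [TopologicalSpace M]
  [ChartedSpace (EuclideanSpace ℝ (Fin (2 * n))) M]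

instance (m : M) : FiniteDimensional ℝ (TangentSpace (𝓡 (2 * n)) m) :=
  inferInstanceAs (FiniteDimensional ℝ (EuclideanSpace ℝ (Fin (2 * n))))

theorem SymplecticForm.flip_nondegenerate (Ω : SymplecticForm n M) (m : M) :
    (Ω.form m).flip.Nondegenerate := by
  refine ⟨fun y hy => Ω.nondegenerate m y fun x => hy x, fun x hx => ?_⟩
  refine Ω.nondegenerate m x fun y => ?_
  have h : Ω.form m x y = 0 := hx y
  rw [Ω.antisymm, h, neg_zero]

/-- The isomorphism `J` from the cotangent to the tangent space, `Ω (x, J a) = a x`. -/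
def SymplecticForm.J (Ω : SymplecticForm n M) (m : M) :
    Module.Dual ℝ (TangentSpace (𝓡 (2 * n)) m) ≃ₗ[ℝ] TangentSpace (𝓡 (2 * n)) m :=
  ((Ω.form m).flip.toDual (Ω.flip_nondegenerate m)).symm

theorem SymplecticForm.form_J (Ω : SymplecticForm n M) (m : M)
    (a : Module.Dual ℝ (TangentSpace (𝓡 (2 * n)) m)) (x : TangentSpace (𝓡 (2 * n)) m) :
    Ω.form m x (Ω.J m a) = a x :=
  LinearMap.BilinForm.apply_toDual_symm_apply (hB := Ω.flip_nondegenerate m) a x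

/-- The differential of a real function, as a covector. -/
def differential (F : M → ℝ) (m : M) : Module.Dual ℝ (TangentSpace (𝓡 (2 * n)) m) :=
  (mfderiv (𝓡 (2 * n)) 𝓘(ℝ, ℝ) F m : TangentSpace (𝓡 (2 * n)) m →L[ℝ] ℝ).toLinearMap

/-- The Hamiltonian vector field `J dF`. -/
def hamiltonianField (Ω : SymplecticForm n M) (F : M → ℝ) (m : M) : TangentSpace (𝓡 (2 * n)) m :=
  Ω.J m (differential F m)

/-- The Poisson bracket `[F, G] = Ω (J dF, J dG)`. -/
def poissonBracket (Ω : SymplecticForm n M) (F G : M → ℝ) (m : M) : ℝ :=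
  Ω.form m (hamiltonianField Ω F m) (hamiltonianField Ω G m)

/-- `g` is the global Hamiltonian flow of `F`: `g t m` is the value at time `t` of a solution of
`ẋ = J dF(x)`, defined on the whole of `ℝ`, which is at `m` at time `0`. -/
def IsHamiltonianFlow (Ω : SymplecticForm n M) (F : M → ℝ) (g : ℝ → M → M) : Prop :=
  ∀ m : M, g 0 m = m ∧
    IsMIntegralCurve (I := 𝓡 (2 * n)) (fun t : ℝ => g t m) (hamiltonianField Ω F)

/-- The derivative of the map `f` at `m`, complexified. -/
def complexDerivative (f : M → M) (m : M) :
    (ℂ ⊗[ℝ] TangentSpace (𝓡 (2 * n)) m) →ₗ[ℂ] (ℂ ⊗[ℝ] TangentSpace (𝓡 (2 * n)) (f m)) :=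
  (mfderiv (𝓡 (2 * n)) (𝓡 (2 * n)) f m).toLinearMap.baseChange ℂ

end Symplectic

/-! ### Tori and complex germs -/

section Torus

variable {n k : ℕ} {M : Type*} [TopologicalSpace M]
  [ChartedSpace (EuclideanSpace ℝ (Fin (2 * n))) M]

/-- `p` is the composition of the universal covering `ℝ^k → S¹ × ⋯ × S¹`,
`s ↦ (exp (i s₁), …, exp (i s_k))`, with a smooth embedding of the torus in `M` (an injective
immersion; the torus being compact, it is a homeomorphism onto its image in a Hausdorff `M`). The
embedded torus is `Set.range p`. -/
structure IsTorusParametrization (p : (Fin k → ℝ) → M) : Prop where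
  smooth : ContMDiff 𝓘(ℝ, Fin k → ℝ) (𝓡 (2 * n)) ∞ p
  immersion : ∀ s, Function.Injective (mfderiv 𝓘(ℝ, Fin k → ℝ) (𝓡 (2 * n)) p s)
  eq_iff : ∀ s s', p s = p s' ↔ ∀ j, Circle.exp (s j) = Circle.exp (s' j)

/-- The tangent space of the torus at the point `p s`. -/
def torusTangent (p : (Fin k → ℝ) → M) (s : Fin k → ℝ) :
    Submodule ℝ (TangentSpace (𝓡 (2 * n)) (p s)) :=
  LinearMap.range (mfderiv 𝓘(ℝ, Fin k → ℝ) (𝓡 (2 * n)) p s).toLinearMap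

/-- The torus is isotropic. -/
def IsIsotropicTorus (Ω : SymplecticForm n M) (p : (Fin k → ℝ) → M) : Prop :=
  ∀ s, ∀ u ∈ torusTangent p s, ∀ v ∈ torusTangent p s, Ω.form (p s) u v = 0

/-- A family of complex subspaces of rank `n` of the complexified tangent spaces, given along the
torus, is smooth if near each point of the torus it is spanned by `n` smooth complex vector fields
`a i + √-1 b i` along the torus. Values off the torus are irrelevant. -/
def IsSmoothAlong [IsManifold (𝓡 (2 * n)) ∞ M] (p : (Fin k → ℝ) → M)
    (r : ∀ m : M, Submodule ℂ (ℂ ⊗[ℝ] TangentSpace (𝓡 (2 * n)) m)) : Prop :=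
  ∀ s₀ : Fin k → ℝ, ∃ U ∈ 𝓝 s₀, ∃ a b : Fin n → ∀ s, TangentSpace (𝓡 (2 * n)) (p s),
    (∀ i, ContMDiffOn 𝓘(ℝ, Fin k → ℝ) (𝓡 (2 * n)).tangent ∞
      (fun s => (⟨p s, a i s⟩ : TangentBundle (𝓡 (2 * n)) M)) U) ∧
    (∀ i, ContMDiffOn 𝓘(ℝ, Fin k → ℝ) (𝓡 (2 * n)).tangent ∞
      (fun s => (⟨p s, b i s⟩ : TangentBundle (𝓡 (2 * n)) M)) U) ∧
    ∀ s ∈ U, r (p s) = Submodule.span ℂ (Set.range fun i =>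
      (1 : ℂ) ⊗ₜ[ℝ] a i s + Complex.I ⊗ₜ[ℝ] b i s)

/-- `r` is a complex germ on the torus, invariant under the flows `g j`. Only the values of `r` at
the points of the torus matter. -/
structure IsComplexGerm [IsManifold (𝓡 (2 * n)) ∞ M] (Ω : SymplecticForm n M)
    (g : Fin k → ℝ → M → M) (p : (Fin k → ℝ) → M)
    (r : ∀ m : M, Submodule ℂ (ℂ ⊗[ℝ] TangentSpace (𝓡 (2 * n)) m)) : Prop where
  smooth : IsSmoothAlong p r
  lagrangian : ∀ s, IsLagrangian (Ω.form (p s)) (r (p s))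
  contains : ∀ s, (torusTangent p s).baseChange ℂ ≤ r (p s)
  dissipative : ∀ s, IsDissipative (Ω.form (p s)) (torusTangent p s) (r (p s))
  invariant : ∀ (j : Fin k) (t : ℝ) (s : Fin k → ℝ),
    (r (p s)).map (complexDerivative (g j t) (p s)) = r (g j t (p s))

/-! ### Monodromy -/

/-- The action `g^t = g₁^{t₁} ∘ ⋯ ∘ g_k^{t_k}` of `ℝ^k`. -/
def jointFlow (g : Fin k → ℝ → M → M) (t : Fin k → ℝ) : M → M :=
  (List.ofFn fun j => g j (t j)).foldr (fun f h => f ∘ h) id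

/-- The periods: all `T ∈ ℝ^k` with `g^T m = m`. -/
def periods (g : Fin k → ℝ → M → M) (m : M) : Set (Fin k → ℝ) :=
  {T | jointFlow g T m = m}

/-- The monodromy operator with period `T`, the derivative of `g^T` at `m`. Since `g^T m = m`, the
tangent spaces at `g^T m` and at `m` are the same space. -/
def monodromy (g : Fin k → ℝ → M → M) (m : M) (T : periods g m) :
    TangentSpace (𝓡 (2 * n)) m →ₗ[ℝ] TangentSpace (𝓡 (2 * n)) m :=
  have h : jointFlow g (T : Fin k → ℝ) m = m := T.2
  (h ▸ mfderiv (𝓡 (2 * n)) (𝓡 (2 * n)) (jointFlow g (T : Fin k → ℝ)) m :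
    TangentSpace (𝓡 (2 * n)) m →L[ℝ] TangentSpace (𝓡 (2 * n)) m).toLinearMap

/-- The tangent space at `m` of the joint level set of `F₁, …, F_k` through `m`. -/
def levelTangent (F : Fin k → M → ℝ) (m : M) : Submodule ℝ (TangentSpace (𝓡 (2 * n)) m) :=
  ⨅ j, LinearMap.ker (differential (F j) m)

/-- The reduced space at the point `p s` of the torus: the tangent space of the joint level set
modulo the tangent space of the torus (which lies in it if the torus is invariant). -/
abbrev reducedSpace (F : Fin k → M → ℝ) (p : (Fin k → ℝ) → M) (s : Fin k → ℝ) : Type :=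
  levelTangent (n := n) F (p s) ⧸ (torusTangent (n := n) p s).submoduleOf (levelTangent F (p s))

/-- The canonical projection onto the reduced space. -/
def reduction (F : Fin k → M → ℝ) (p : (Fin k → ℝ) → M) (s : Fin k → ℝ) :
    levelTangent (n := n) F (p s) →ₗ[ℝ] reducedSpace (n := n) F p s :=
  Submodule.mkQ _

/-- `β` is the form on the reduced space with `β ([θ], [θ']) = Ω (θ, θ')`; there is at most one. -/
def IsReducedForm (Ω : SymplecticForm n M) (F : Fin k → M → ℝ) (p : (Fin k → ℝ) → M)
    (s : Fin k → ℝ) (β : LinearMap.BilinForm ℝ (reducedSpace (n := n) F p s)) : Prop :=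
  ∀ θ θ' : levelTangent (n := n) F (p s),
    β (reduction F p s θ) (reduction F p s θ') = Ω.form (p s) θ θ'

/-- `Ξ` is the reduced monodromy operator with period `T`: the monodromy operator `G` maps the
tangent space of the level set into itself and `Ξ [θ] = [G θ]`; there is at most one such `Ξ`. -/
def IsReducedMonodromy (F : Fin k → M → ℝ) (g : Fin k → ℝ → M → M) (p : (Fin k → ℝ) → M)
    (s : Fin k → ℝ) (T : periods g (p s))
    (Ξ : reducedSpace (n := n) F p s →ₗ[ℝ] reducedSpace (n := n) F p s) : Prop :=
  ∀ θ : levelTangent (n := n) F (p s), ∃ θ' : levelTangent (n := n) F (p s),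
    (θ' : TangentSpace (𝓡 (2 * n)) (p s)) = monodromy g (p s) T θ ∧
      Ξ (reduction F p s θ) = reduction F p s θ'

/-- The projection to the complexified reduced space of (the part in the complexified tangent space
of the level set of) a complex subspace `L`. -/
def reducedSubspace (F : Fin k → M → ℝ) (p : (Fin k → ℝ) → M) (s : Fin k → ℝ)
    (L : Submodule ℂ (ℂ ⊗[ℝ] TangentSpace (𝓡 (2 * n)) (p s))) :
    Submodule ℂ (ℂ ⊗[ℝ] reducedSpace (n := n) F p s) :=
  (L.comap ((levelTangent (n := n) F (p s)).subtype.baseChange ℂ)).map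
    ((reduction F p s).baseChange ℂ)

end Torus

end ComplexGerm

end

/-! Write `N` for the tangent space of the torus, `W` for that of the level set, `L` for the germ at
the point. An orbit of `g j` stays in the torus, so the fields `J dF_j` are tangent to it
(`velocity_mem_torusTangent`); being `k` independent vectors, they span `N`. Hence `W` is the
`ω`-orthogonal of `N` (`mem_levelTangent_iff_torusTangent`), and isotropy gives `N ≤ W`. What
follows is linear symplectic reduction: the form descends to `W/N` and is non-degenerate there
because `N` is its own double orthogonal. Since `L` is isotropic and contains the complexification
of `N`, it lies in that of `W`, and dimensions are counted. Dissipativity of `L` outside `N` becomes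
positivity of the quotient `R`.

A monodromy operator `S` is symplectic and preserves `L`. The value `(1/2i)[x, x̄]` vanishes at real
vectors, so by dissipativity the real vectors of `L` are exactly those of `N`; therefore `S`
preserves `N`, then its orthogonal `W`, and induces `Ξ` on `W/N`, which preserves the form and `R`
(`exists_reduced_operator`).

Stability is a compactness argument (`bounded_orbits_of_isPositive`). The positive hermitian form on
`R` is a `Ξ`-invariant norm, and taking real parts is a real isomorphism from `R` onto `W/N`
commuting with `Ξ`. So all orbits of `Ξ` are bounded, which in finite dimension is stability, and
the matrix is the same on the complexification.

The analytic input is that the flows are symplectic along the torus. Differentiability there is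
forced by invariance of the germ (`IsComplexGerm.mdifferentiableAt`). In a chart the derivative of
the flow has the linearized field as its time derivative at `0` (`hasDerivAt_fderiv_localFlow`);
closedness of the form and symmetry of the Hessian then make the pulled back form stationary at time
`0` (`hasDerivAt_form_localFlow`), and the group law carries this to all times
(`pullbackForm_flow`). -/

noncomputable section

namespace ComplexGerm

/-! ### Real and imaginary parts in `ℂ ⊗ V` -/

section Complexification

variable {V W : Type*} [AddCommGroup V] [Module ℝ V] [AddCommGroup W] [Module ℝ W]

/-- The real part of an element of the complexification of a real space. -/
def rePart (V : Type*) [AddCommGroup V] [Module ℝ V] : (ℂ ⊗[ℝ] V) →ₗ[ℝ] V :=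
  (TensorProduct.lid ℝ V).toLinearMap ∘ₗ TensorProduct.map Complex.reLm LinearMap.id

/-- The imaginary part of an element of the complexification of a real space. -/
def imPart (V : Type*) [AddCommGroup V] [Module ℝ V] : (ℂ ⊗[ℝ] V) →ₗ[ℝ] V :=
  (TensorProduct.lid ℝ V).toLinearMap ∘ₗ TensorProduct.map Complex.imLm LinearMap.id

@[simp] theorem rePart_tmul (c : ℂ) (v : V) : rePart V (c ⊗ₜ v) = c.re • v := by simp [rePart]

@[simp] theorem imPart_tmul (c : ℂ) (v : V) : imPart V (c ⊗ₜ v) = c.im • v := by simp [imPart]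

theorem eq_rePart_add_imPart (x : ℂ ⊗[ℝ] V) :
    x = (1 : ℂ) ⊗ₜ rePart V x + Complex.I ⊗ₜ imPart V x := by
  induction x with
  | zero => simp
  | tmul c v =>
    rw [rePart_tmul, imPart_tmul, ← TensorProduct.smul_tmul, ← TensorProduct.smul_tmul,
      ← TensorProduct.add_tmul]
    congr 1
    apply Complex.ext <;> simp
  | add x y hx hy =>
    rw [map_add, map_add, TensorProduct.tmul_add, TensorProduct.tmul_add]
    nth_rewrite 1 [hx]
    nth_rewrite 1 [hy]
    abel

theorem complexification_ext {x y : ℂ ⊗[ℝ] V} (hr : rePart V x = rePart V y)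
    (hi : imPart V x = imPart V y) : x = y := by
  rw [eq_rePart_add_imPart x, eq_rePart_add_imPart y, hr, hi]

@[simp] theorem rePart_baseChange (f : V →ₗ[ℝ] W) (x : ℂ ⊗[ℝ] V) :
    rePart W (f.baseChange ℂ x) = f (rePart V x) := by
  induction x with
  | zero => simp
  | tmul c v => simp
  | add x y hx hy => simp [hx, hy]

@[simp] theorem imPart_baseChange (f : V →ₗ[ℝ] W) (x : ℂ ⊗[ℝ] V) :
    imPart W (f.baseChange ℂ x) = f (imPart V x) := by
  induction x with
  | zero => simp
  | tmul c v => simp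
  | add x y hx hy => simp [hx, hy]

@[simp] theorem rePart_conj (x : ℂ ⊗[ℝ] V) : rePart V (conj V x) = rePart V x := by
  induction x with
  | zero => simp
  | tmul c v => simp [conj]
  | add x y hx hy => simp [hx, hy]

@[simp] theorem imPart_conj (x : ℂ ⊗[ℝ] V) : imPart V (conj V x) = -imPart V x := by
  induction x with
  | zero => simp
  | tmul c v => simp [conj]
  | add x y hx hy => rw [map_add, map_add, map_add, hx, hy]; abel

theorem mem_baseChange_iff (N : Submodule ℝ V) (x : ℂ ⊗[ℝ] V) :
    x ∈ N.baseChange ℂ ↔ rePart V x ∈ N ∧ imPart V x ∈ N := by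
  constructor
  · intro hx
    obtain ⟨y, rfl⟩ := hx
    simp
  · rintro ⟨hr, hi⟩
    rw [eq_rePart_add_imPart x]
    exact add_mem (Submodule.tmul_mem_baseChange_of_mem _ hr)
      (Submodule.tmul_mem_baseChange_of_mem _ hi)

theorem baseChange_injective {f : V →ₗ[ℝ] W} (hf : Function.Injective f) :
    Function.Injective (f.baseChange ℂ) := by
  intro x y h
  refine complexification_ext (hf ?_) (hf ?_)
  · rw [← rePart_baseChange, h, rePart_baseChange]
  · rw [← imPart_baseChange, h, imPart_baseChange]

theorem finrank_baseChange_submodule (N : Submodule ℝ V) :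
    Module.finrank ℂ (N.baseChange ℂ) = Module.finrank ℝ N := by
  rw [Submodule.baseChange, LinearMap.finrank_range_of_inj (baseChange_injective N.injective_subtype),
    Module.finrank_baseChange]

theorem bilinForm_baseChange_apply (B : LinearMap.BilinForm ℝ V) (x y : ℂ ⊗[ℝ] V) :
    B.baseChange ℂ x y =
      ((B (rePart V x) (rePart V y) - B (imPart V x) (imPart V y) : ℝ) : ℂ) +
      ((B (rePart V x) (imPart V y) + B (imPart V x) (rePart V y) : ℝ) : ℂ) * Complex.I := by
  conv_lhs => rw [eq_rePart_add_imPart x, eq_rePart_add_imPart y]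
  simp only [map_add, LinearMap.add_apply, LinearMap.BilinForm.baseChange_tmul]
  apply Complex.ext <;> simp <;> ring

theorem bilinForm_baseChange_eq_zero_iff (B : LinearMap.BilinForm ℝ V) (x y : ℂ ⊗[ℝ] V) :
    B.baseChange ℂ x y = 0 ↔
      B (rePart V x) (rePart V y) = B (imPart V x) (imPart V y) ∧
      B (rePart V x) (imPart V y) = -B (imPart V x) (rePart V y) := by
  rw [bilinForm_baseChange_apply, Complex.ext_iff]
  simp [sub_eq_zero, add_eq_zero_iff_eq_neg]

theorem bilinForm_baseChange_baseChange {B : LinearMap.BilinForm ℝ V}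
    {C : LinearMap.BilinForm ℝ W} {f : V →ₗ[ℝ] W} (h : ∀ u v, C (f u) (f v) = B u v)
    (x y : ℂ ⊗[ℝ] V) :
    C.baseChange ℂ (f.baseChange ℂ x) (f.baseChange ℂ y) = B.baseChange ℂ x y := by
  simp only [bilinForm_baseChange_apply, rePart_baseChange, imPart_baseChange, h]

/-- For antisymmetric `B` and `x = u + iv` this is `B v u`. It vanishes on real and on purely
imaginary vectors, the fact behind both injectivity of the real part on `R` and invariance of `N`.
-/
theorem hermitianValue_eq (B : LinearMap.BilinForm ℝ V) (x : ℂ ⊗[ℝ] V) :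
    hermitianValue B x =
      (B (imPart V x) (rePart V x) - B (rePart V x) (imPart V x)) / 2 := by
  rw [hermitianValue, bilinForm_baseChange_apply]
  simp only [rePart_conj, imPart_conj, map_neg, one_div, mul_inv, Complex.inv_I]
  simp [Complex.mul_re]
  ring

theorem hermitianValue_baseChange {B : LinearMap.BilinForm ℝ V}
    {C : LinearMap.BilinForm ℝ W} {f : V →ₗ[ℝ] W} (h : ∀ u v, C (f u) (f v) = B u v)
    (x : ℂ ⊗[ℝ] V) :
    hermitianValue C (f.baseChange ℂ x) = hermitianValue B x := by
  simp only [hermitianValue_eq, rePart_baseChange, imPart_baseChange, h]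

end Complexification

/-! ### Stability from an invariant positive Lagrangian subspace -/

section Stability

/-- Bounded matrix entries of all powers give a single constant `D` with `N (Sⁿ x) ≤ D * N x`,
because coordinates are continuous for any norm in finite dimension. -/
theorem isStable_of_bounded_repr {𝕜 V ι : Type*} [RCLike 𝕜] [AddCommGroup V] [Module 𝕜 V]
    [Fintype ι] (b : Module.Basis ι 𝕜 V) (S : V →ₗ[𝕜] V)
    (h : ∀ i j, ∃ C : ℝ, ∀ n : ℕ, ‖b.repr ((S ^ n) (b i)) j‖ ≤ C) : IsStable S := by
  intro N hN ε hε
  choose C hC using h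
  let : Norm V := ⟨N⟩
  have core : NormedSpace.Core 𝕜 V :=
    { norm_nonneg := fun x => apply_nonneg N x
      norm_smul := fun c x => map_smul_eq_mul N c x
      norm_triangle := fun x y => map_add_le_add N x y
      norm_eq_zero_iff := fun x => ⟨hN x, fun hx => by rw [hx]; exact map_zero N⟩ }
  let := NormedAddCommGroup.ofCore core
  let := NormedSpace.ofCore core
  have : FiniteDimensional 𝕜 V := b.finiteDimensional_of_finite
  have hnorm : ∀ x : V, N x = ‖x‖ := fun x => rfl
  have hcoord : ∀ i, ∃ K : ℝ, ∀ x : V, ‖b.repr x i‖ ≤ K * ‖x‖ := fun i =>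
    ⟨_, (LinearMap.toContinuousLinearMap (b.coord i)).le_opNorm⟩
  choose K hK using hcoord
  have hC0 : ∀ i j, 0 ≤ C i j := fun i j => (norm_nonneg _).trans (hC i j 0)
  have hbound : ∀ i (n : ℕ), N ((S ^ n) (b i)) ≤ ∑ j, C i j * N (b j) := by
    intro i n
    conv_lhs => rw [← b.sum_repr ((S ^ n) (b i)), hnorm]
    refine (norm_sum_le _ _).trans (Finset.sum_le_sum fun j _ => ?_)
    rw [norm_smul]
    exact mul_le_mul_of_nonneg_right (hC i j n) (norm_nonneg _)
  set D : ℝ := ∑ i, |K i| * ∑ j, C i j * N (b j) with hD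
  have hD0 : 0 ≤ D := Finset.sum_nonneg fun i _ => mul_nonneg (abs_nonneg _)
    (Finset.sum_nonneg fun j _ => mul_nonneg (hC0 i j) (apply_nonneg N _))
  have main : ∀ x (n : ℕ), N ((S ^ n) x) ≤ D * N x := by
    intro x n
    conv_lhs => rw [← b.sum_repr x, map_sum, hnorm]
    refine (norm_sum_le _ _).trans ?_
    rw [hD, Finset.sum_mul]
    refine Finset.sum_le_sum fun i _ => ?_
    rw [map_smul, norm_smul]
    calc ‖b.repr x i‖ * ‖(S ^ n) (b i)‖
        ≤ (|K i| * ‖x‖) * ∑ j, C i j * N (b j) := by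
          refine mul_le_mul ((hK i x).trans ?_) (hbound i n) (norm_nonneg _) (by positivity)
          exact mul_le_mul_of_nonneg_right (le_abs_self _) (norm_nonneg _)
      _ = _ := by rw [hnorm x]; ring
  -- `D` may be zero, hence the `+ 1`.
  refine ⟨ε / (D + 1), by positivity, fun x hx n _ => (main x n).trans_lt ?_⟩
  rw [lt_div_iff₀ (by positivity)] at hx
  nlinarith [apply_nonneg N x]

variable {V : Type*} [AddCommGroup V] [Module ℝ V]

/-- A vector with zero real part is purely imaginary and has hermitian value `0`. -/
theorem rePart_injOn_of_isPositive {β : LinearMap.BilinForm ℝ V} {R : Submodule ℂ (ℂ ⊗[ℝ] V)}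
    (hpos : IsPositive β R) :
    Function.Injective ((rePart V).domRestrict (R.restrictScalars ℝ)) := by
  rw [← LinearMap.ker_eq_bot, LinearMap.ker_eq_bot']
  rintro ⟨x, hx⟩ h0
  by_contra hne
  have h0' : rePart V x = 0 := h0
  have := hpos x hx fun h => hne (Subtype.ext h)
  simp [hermitianValue_eq, h0'] at this

/-- The Lagrangian condition makes the real dimensions of `R` and `V` equal, so injectivity of the
real part gives surjectivity. -/
theorem exists_rePart_eq [FiniteDimensional ℝ V] {β : LinearMap.BilinForm ℝ V}
    {R : Submodule ℂ (ℂ ⊗[ℝ] V)} (hL : IsLagrangian β R) (hpos : IsPositive β R) (v : V) :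
    ∃ x ∈ R, rePart V x = v := by
  have hdim : Module.finrank ℝ (R.restrictScalars ℝ) = Module.finrank ℝ V := by
    rw [← hL.2, ← finrank_real_of_complex]
    rfl
  have : FiniteDimensional ℂ R := inferInstance
  have : FiniteDimensional ℝ (R.restrictScalars ℝ) := FiniteDimensional.complexToReal R
  obtain ⟨x, hx⟩ := (LinearMap.injective_iff_surjective_of_finrank_eq_finrank hdim).1
    (rePart_injOn_of_isPositive hpos) v
  exact ⟨x, x.2, hx⟩

theorem bounded_orbits_of_isPositive [FiniteDimensional ℝ V] {β : LinearMap.BilinForm ℝ V}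
    {R : Submodule ℂ (ℂ ⊗[ℝ] V)} (hL : IsLagrangian β R) (hpos : IsPositive β R)
    {S : V →ₗ[ℝ] V} (hS : ∀ u v, β (S u) (S v) = β u v)
    (hR : ∀ x ∈ R, S.baseChange ℂ x ∈ R) (f : V →ₗ[ℝ] ℝ) (v : V) :
    ∃ C : ℝ, ∀ n : ℕ, ‖f ((S ^ n) v)‖ ≤ C := by
  obtain ⟨x, hx, rfl⟩ := exists_rePart_eq hL hpos v
  have : FiniteDimensional ℝ (R.restrictScalars ℝ) := FiniteDimensional.complexToReal R
  -- The polarization of the hermitian value, symmetrized so that antisymmetry of `β` is not needed.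
  let q : (R.restrictScalars ℝ) → (R.restrictScalars ℝ) → ℝ := fun y z =>
    (β (imPart V y) (rePart V z) - β (rePart V y) (imPart V z)
      + β (imPart V z) (rePart V y) - β (rePart V z) (imPart V y)) / 4
  have hq : ∀ y, q y y = hermitianValue β y := fun y => by
    simp only [q, hermitianValue_eq]; ring
  let core : InnerProductSpace.Core ℝ (R.restrictScalars ℝ) :=
    { inner := q
      conj_inner_symm := fun y z => by simp only [q, conj_trivial]; ring
      re_inner_nonneg := fun y => by
        change 0 ≤ q y y
        rw [hq]
        by_cases hy : (y : ℂ ⊗[ℝ] V) = 0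
        · rw [hy, hermitianValue_eq]; simp
        · exact (hpos y y.2 hy).le
      add_left := fun y z w => by simp [q]; ring
      smul_left := fun y z c => by simp [q]; ring
      definite := fun y hy => by
        by_contra hne
        have h1 := hpos y y.2 fun h => hne (Subtype.ext h)
        rw [← hq] at h1
        exact h1.ne' hy }
  let : NormedAddCommGroup (R.restrictScalars ℝ) := core.toNormedAddCommGroup
  let : InnerProductSpace ℝ (R.restrictScalars ℝ) := InnerProductSpace.ofCore core.toCore
  have hnorm : ∀ y : R.restrictScalars ℝ, ‖y‖ = Real.sqrt (hermitianValue β y) := fun y => by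
    rw [← hq]; rfl
  -- The orbit of `v` lifts to `R` with constant norm; a linear functional of the real part is
  -- continuous on `R`, hence bounded on the lift.
  have hiter : ∀ n : ℕ, ∃ y : R.restrictScalars ℝ, rePart V y = (S ^ n) (rePart V x) ∧
      hermitianValue β y = hermitianValue β x := by
    intro n
    induction n with
    | zero => exact ⟨⟨x, hx⟩, rfl, rfl⟩
    | succ n ih =>
      obtain ⟨y, hy1, hy2⟩ := ih
      refine ⟨⟨S.baseChange ℂ y, hR y y.2⟩, ?_, ?_⟩
      · simp [hy1, pow_succ']
      · simp only
        rw [hermitianValue_baseChange hS, hy2]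
  let φ : (R.restrictScalars ℝ) →L[ℝ] ℝ :=
    LinearMap.toContinuousLinearMap (f ∘ₗ (rePart V).domRestrict (R.restrictScalars ℝ))
  refine ⟨‖φ‖ * Real.sqrt (hermitianValue β x), fun n => ?_⟩
  obtain ⟨y, hy1, hy2⟩ := hiter n
  have := φ.le_opNorm y
  rw [hnorm, hy2] at this
  rw [← hy1]
  exact this

theorem isStable_of_isPositive [FiniteDimensional ℝ V] {β : LinearMap.BilinForm ℝ V}
    {R : Submodule ℂ (ℂ ⊗[ℝ] V)} (hL : IsLagrangian β R) (hpos : IsPositive β R)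
    {S : V →ₗ[ℝ] V} (hS : ∀ u v, β (S u) (S v) = β u v)
    (hR : ∀ x ∈ R, S.baseChange ℂ x ∈ R) : IsStable S ∧ IsStable (S.baseChange ℂ) := by
  have b := Module.finBasis ℝ V
  have h := fun i j => bounded_orbits_of_isPositive hL hpos hS hR (b.coord j) (b i)
  refine ⟨isStable_of_bounded_repr b S h,
    isStable_of_bounded_repr (b.baseChange ℂ) (S.baseChange ℂ) fun i j => ?_⟩
  obtain ⟨C, hC⟩ := h i j
  refine ⟨C, fun n => ?_⟩
  -- In the basis `1 ⊗ b i` the powers of the complexified operator have the same real matrix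
  -- entries.
  have hn : ((S.baseChange ℂ) ^ n) (1 ⊗ₜ b i) = 1 ⊗ₜ (S ^ n) (b i) := by
    rw [← LinearMap.baseChange_pow]; simp
  simpa [hn] using hC n

end Stability

/-! ### Linear symplectic reduction from `W = N^⊥` to `W / N` -/

section Reduction

variable {V : Type*} [AddCommGroup V] [Module ℝ V] {B : LinearMap.BilinForm ℝ V}
  {N W : Submodule ℝ V}

/-- The image in the complexification of `W ⧸ N` of the part of `L` in the complexification
of `W`. -/
def quotientImage (N W : Submodule ℝ V) (L : Submodule ℂ (ℂ ⊗[ℝ] V)) :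
    Submodule ℂ (ℂ ⊗[ℝ] (W ⧸ N.submoduleOf W)) :=
  (L.comap (W.subtype.baseChange ℂ)).map ((N.submoduleOf W).mkQ.baseChange ℂ)

/-- `N` pairs to zero with `W` on either side, so the form descends in one argument and, after a
flip, in the other. -/
theorem exists_reducedForm (hanti : ∀ x y, B x y = -B y x)
    (hW : ∀ x, x ∈ W ↔ ∀ u ∈ N, B x u = 0) :
    ∃ β : LinearMap.BilinForm ℝ (W ⧸ N.submoduleOf W), ∀ θ θ' : W,
      β ((N.submoduleOf W).mkQ θ) ((N.submoduleOf W).mkQ θ') = B θ θ' := by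
  let f : W →ₗ[ℝ] W →ₗ[ℝ] ℝ := B.domRestrict₁₂ W W
  have hf : N.submoduleOf W ≤ LinearMap.ker f := by
    intro u hu
    rw [LinearMap.mem_ker]
    ext w
    change B u w = 0
    rw [hanti, (hW w).1 w.2 u hu, neg_zero]
  let f₁ := (N.submoduleOf W).liftQ f hf
  have hf₁ : N.submoduleOf W ≤ LinearMap.ker f₁.flip := by
    intro u hu
    rw [LinearMap.mem_ker]
    ext w
    change B w u = 0
    exact (hW w).1 w.2 u hu
  exact ⟨((N.submoduleOf W).liftQ f₁.flip hf₁).flip, fun θ θ' => rfl⟩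

variable {β : LinearMap.BilinForm ℝ (W ⧸ N.submoduleOf W)}

/-- The double orthogonal of `N` is `N`. -/
theorem mem_of_forall_eq_zero [FiniteDimensional ℝ V] (hanti : ∀ x y, B x y = -B y x)
    (hnd : B.Nondegenerate) (hW : ∀ x, x ∈ W ↔ ∀ u ∈ N, B x u = 0) {x : V}
    (hx : ∀ w ∈ W, B x w = 0) : x ∈ N := by
  have hrefl : B.IsRefl := fun a b h => by rw [hanti, h, neg_zero]
  have hWo : B.orthogonal N = W := by
    ext y
    rw [LinearMap.BilinForm.mem_orthogonal_iff, hW]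
    exact forall₂_congr fun u _ => ⟨fun h => hrefl _ _ h, fun h => hrefl _ _ h⟩
  rw [← LinearMap.BilinForm.orthogonal_orthogonal hnd hrefl N, hWo,
    LinearMap.BilinForm.mem_orthogonal_iff]
  exact fun w hw => hrefl _ _ (hx w hw)

theorem reducedForm_nondegenerate [FiniteDimensional ℝ V] (hanti : ∀ x y, B x y = -B y x)
    (hnd : B.Nondegenerate) (hW : ∀ x, x ∈ W ↔ ∀ u ∈ N, B x u = 0)
    (hβ : ∀ θ θ' : W, β ((N.submoduleOf W).mkQ θ) ((N.submoduleOf W).mkQ θ') = B θ θ') :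
    β.Nondegenerate := by
  have key : ∀ x : W, (∀ y : W, B x y = 0) → (N.submoduleOf W).mkQ x = 0 := by
    intro x hx
    rw [Submodule.mkQ_apply, Submodule.Quotient.mk_eq_zero]
    exact mem_of_forall_eq_zero hanti hnd hW fun w hw => hx ⟨w, hw⟩
  constructor
  · intro x hx
    obtain ⟨x, rfl⟩ := (N.submoduleOf W).mkQ_surjective x
    exact key x fun y => by rw [← hβ]; exact hx _
  · intro x hx
    obtain ⟨x, rfl⟩ := (N.submoduleOf W).mkQ_surjective x
    exact key x fun y => by rw [hanti, ← hβ, hx, neg_zero]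

theorem mkQ_baseChange_eq_zero_iff (y : ℂ ⊗[ℝ] W) :
    (N.submoduleOf W).mkQ.baseChange ℂ y = 0 ↔ W.subtype.baseChange ℂ y ∈ N.baseChange ℂ := by
  rw [mem_baseChange_iff, rePart_baseChange, imPart_baseChange]
  constructor
  · intro h
    have hr := rePart_baseChange (N.submoduleOf W).mkQ y
    have hi := imPart_baseChange (N.submoduleOf W).mkQ y
    rw [h, map_zero, eq_comm, Submodule.mkQ_apply, Submodule.Quotient.mk_eq_zero] at hr hi
    exact ⟨hr, hi⟩
  · rintro ⟨hr, hi⟩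
    apply complexification_ext
    · rw [rePart_baseChange, map_zero, Submodule.mkQ_apply, Submodule.Quotient.mk_eq_zero]
      exact hr
    · rw [imPart_baseChange, map_zero, Submodule.mkQ_apply, Submodule.Quotient.mk_eq_zero]
      exact hi

/-- Every `x` in `L` pairs to zero with `N`; since the vectors of `N` are real, its real and
imaginary parts do so separately. -/
theorem le_baseChange_of_isLagrangian (hW : ∀ x, x ∈ W ↔ ∀ u ∈ N, B x u = 0)
    {L : Submodule ℂ (ℂ ⊗[ℝ] V)} (hL : IsLagrangian B L) (hN : N.baseChange ℂ ≤ L) :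
    L ≤ W.baseChange ℂ := by
  intro x hx
  rw [mem_baseChange_iff, hW, hW]
  have h : ∀ u ∈ N, B (rePart V x) u = 0 ∧ B (imPart V x) u = 0 := fun u hu => by
    have := (bilinForm_baseChange_eq_zero_iff B x ((1 : ℂ) ⊗ₜ u)).1
      (hL.1 x hx _ (hN (Submodule.tmul_mem_baseChange_of_mem _ hu)))
    simpa [eq_comm] using this
  exact ⟨fun u hu => (h u hu).1, fun u hu => (h u hu).2⟩

/-- A non-zero class is represented by an element of `L` outside the complexification of `N`, where
dissipativity is strict. -/
theorem isPositive_quotientImage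
    (hβ : ∀ θ θ' : W, β ((N.submoduleOf W).mkQ θ) ((N.submoduleOf W).mkQ θ') = B θ θ')
    {L : Submodule ℂ (ℂ ⊗[ℝ] V)} (hD : IsDissipative B N L) :
    IsPositive β (quotientImage N W L) := by
  rintro _ ⟨y, hy, rfl⟩ hne
  have hne' := (mkQ_baseChange_eq_zero_iff y).not.1 hne
  rw [hermitianValue_baseChange (B := B.domRestrict₁₂ W W) (fun u v => hβ u v) y,
    ← hermitianValue_baseChange (f := W.subtype) (C := B) (fun u v => rfl) y]
  exact hD _ hy hne'

theorem finrank_map_add_finrank_of_ker_le {K A B : Type*} [Field K] [AddCommGroup A] [Module K A]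
    [AddCommGroup B] [Module K B] [FiniteDimensional K A] (f : A →ₗ[K] B) {P : Submodule K A}
    (hP : LinearMap.ker f ≤ P) :
    Module.finrank K (P.map f) + Module.finrank K (LinearMap.ker f) = Module.finrank K P := by
  have h := (f.domRestrict P).finrank_range_add_finrank_ker
  rw [LinearMap.range_domRestrict, LinearMap.ker_domRestrict] at h
  rw [← h]
  congr 1
  exact (Submodule.submoduleOfEquivOfLe hP).finrank_eq.symm

theorem isLagrangian_quotientImage [FiniteDimensional ℝ V] (hanti : ∀ x y, B x y = -B y x)
    (hnd : B.Nondegenerate) (hNW : N ≤ W) (hW : ∀ x, x ∈ W ↔ ∀ u ∈ N, B x u = 0)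
    (hβ : ∀ θ θ' : W, β ((N.submoduleOf W).mkQ θ) ((N.submoduleOf W).mkQ θ') = B θ θ')
    {L : Submodule ℂ (ℂ ⊗[ℝ] V)} (hL : IsLagrangian B L) (hN : N.baseChange ℂ ≤ L) :
    IsLagrangian β (quotientImage N W L) := by
  constructor
  · rintro _ ⟨x, hx, rfl⟩ _ ⟨y, hy, rfl⟩
    rw [bilinForm_baseChange_baseChange (B := B.domRestrict₁₂ W W) (fun u v => hβ u v) x y,
      ← bilinForm_baseChange_baseChange (f := W.subtype) (C := B) (fun u v => rfl) x y]
    exact hL.1 _ hx _ hy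
  · have hrefl : B.IsRefl := fun a b h => by rw [hanti, h, neg_zero]
    have hWo : B.orthogonal N = W := by
      ext y
      rw [LinearMap.BilinForm.mem_orthogonal_iff, hW]
      exact forall₂_congr fun u _ => ⟨fun h => hrefl _ _ h, fun h => hrefl _ _ h⟩
    have hdimW := LinearMap.BilinForm.finrank_orthogonal hnd N
    rw [hWo] at hdimW
    -- The formula for `dim W` is a truncated subtraction `dim V - dim N`, which `omega` can only
    -- use with this bound.
    have hNle := Submodule.finrank_le N
    have hker : LinearMap.ker ((N.submoduleOf W).mkQ.baseChange ℂ) =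
        (N.submoduleOf W).baseChange ℂ := by
      ext y
      rw [LinearMap.mem_ker, mkQ_baseChange_eq_zero_iff, mem_baseChange_iff, mem_baseChange_iff,
        rePart_baseChange, imPart_baseChange]
      rfl
    have hkerle : LinearMap.ker ((N.submoduleOf W).mkQ.baseChange ℂ) ≤
        L.comap (W.subtype.baseChange ℂ) := fun y hy =>
      hN ((mkQ_baseChange_eq_zero_iff y).1 hy)
    have h1 := finrank_map_add_finrank_of_ker_le _ hkerle
    rw [hker, finrank_baseChange_submodule,
      (Submodule.submoduleOfEquivOfLe hNW).finrank_eq] at h1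
    have h2 : Module.finrank ℂ (L.comap (W.subtype.baseChange ℂ)) = Module.finrank ℂ L := by
      rw [(Submodule.equivMapOfInjective _ (baseChange_injective W.injective_subtype)
        (L.comap (W.subtype.baseChange ℂ))).finrank_eq, Submodule.map_comap_eq_of_le]
      exact le_baseChange_of_isLagrangian hW hL hN
    have h3 := (N.submoduleOf W).finrank_quotient_add_finrank
    rw [(Submodule.submoduleOfEquivOfLe hNW).finrank_eq] at h3
    have h4 := hL.2
    change 2 * Module.finrank ℂ ((L.comap (W.subtype.baseChange ℂ)).map
      ((N.submoduleOf W).mkQ.baseChange ℂ)) = _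
    omega

/-- A real operator that preserves a dissipative subspace preserves the real subspace on which
dissipativity degenerates. -/
theorem mapsTo_of_isDissipative {L : Submodule ℂ (ℂ ⊗[ℝ] V)} (hN : N.baseChange ℂ ≤ L)
    (hD : IsDissipative B N L) {S : V →ₗ[ℝ] V} (hS : ∀ x ∈ L, S.baseChange ℂ x ∈ L)
    {u : V} (hu : u ∈ N) : S u ∈ N := by
  have hx := hS _ (hN (Submodule.tmul_mem_baseChange_of_mem (1 : ℂ) hu))
  by_contra hne
  have hpos := hD _ hx fun h => hne (by simpa using ((mem_baseChange_iff N _).1 h).1)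
  -- `S u` is real, so its hermitian value is `0`.
  simp [hermitianValue_eq] at hpos

theorem injective_of_preserves {A : Type*} [AddCommGroup A] [Module ℝ A]
    {C : LinearMap.BilinForm ℝ A} (hnd : C.Nondegenerate) {S : A →ₗ[ℝ] A}
    (hS : ∀ x y, C (S x) (S y) = C x y) : Function.Injective S := by
  rw [← LinearMap.ker_eq_bot, LinearMap.ker_eq_bot']
  intro x hx
  exact hnd.1 x fun y => by rw [← hS, hx, map_zero, LinearMap.zero_apply]

theorem map_eq_self_of_mapsTo {K A : Type*} [Field K] [AddCommGroup A] [Module K A]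
    [FiniteDimensional K A] {S : A →ₗ[K] A} (hinj : Function.Injective S) {P : Submodule K A}
    (hP : ∀ x ∈ P, S x ∈ P) : P.map S = P := by
  refine Submodule.eq_of_le_of_finrank_eq (Submodule.map_le_iff_le_comap.2 hP) ?_
  exact (Submodule.equivMapOfInjective S hinj P).finrank_eq.symm

theorem exists_reduced_operator [FiniteDimensional ℝ V] (hanti : ∀ x y, B x y = -B y x)
    (hnd : B.Nondegenerate) (hNW : N ≤ W) (hW : ∀ x, x ∈ W ↔ ∀ u ∈ N, B x u = 0)
    (hβ : ∀ θ θ' : W, β ((N.submoduleOf W).mkQ θ) ((N.submoduleOf W).mkQ θ') = B θ θ')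
    {L : Submodule ℂ (ℂ ⊗[ℝ] V)} (hL : IsLagrangian B L) (hN : N.baseChange ℂ ≤ L)
    (hD : IsDissipative B N L) {S : V →ₗ[ℝ] V} (hS : ∀ x y, B (S x) (S y) = B x y)
    (hSL : ∀ x ∈ L, S.baseChange ℂ x ∈ L) :
    ∃ Ξ : (W ⧸ N.submoduleOf W) →ₗ[ℝ] (W ⧸ N.submoduleOf W),
      (∀ θ : W, ∃ θ' : W, (θ' : V) = S θ ∧
        Ξ ((N.submoduleOf W).mkQ θ) = (N.submoduleOf W).mkQ θ') ∧
      (quotientImage N W L).map (Ξ.baseChange ℂ) = quotientImage N W L ∧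
      IsStable Ξ ∧ IsStable (Ξ.baseChange ℂ) := by
  have hSN : N.map S = N := map_eq_self_of_mapsTo (injective_of_preserves hnd hS)
    fun u hu => mapsTo_of_isDissipative hN hD hSL hu
  have hSW : ∀ w ∈ W, S w ∈ W := by
    intro w hw
    rw [hW]
    intro u hu
    -- The equality `S N = N`, not just the inclusion, is needed: writing a vector of `N` as `S u`
    -- reduces the pairing with `S w` to that of `w` with `u`.
    rw [← hSN] at hu
    obtain ⟨u, hu, rfl⟩ := hu
    rw [hS]
    exact (hW w).1 hw u hu
  let SW : W →ₗ[ℝ] W := S.restrict hSW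
  let Ξ := (N.submoduleOf W).mapQ (N.submoduleOf W) SW fun u hu => by
    change S u ∈ N
    rw [← hSN]
    exact Submodule.mem_map_of_mem hu
  have hΞ : ∀ θ : W, Ξ ((N.submoduleOf W).mkQ θ) = (N.submoduleOf W).mkQ (SW θ) := fun θ => rfl
  have hΞβ : ∀ x y, β (Ξ x) (Ξ y) = β x y := by
    intro x y
    obtain ⟨x, rfl⟩ := (N.submoduleOf W).mkQ_surjective x
    obtain ⟨y, rfl⟩ := (N.submoduleOf W).mkQ_surjective y
    rw [hΞ, hΞ, hβ, hβ]
    exact hS x y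
  have hΞR : ∀ x ∈ quotientImage N W L, Ξ.baseChange ℂ x ∈ quotientImage N W L := by
    rintro _ ⟨y, hy, rfl⟩
    refine ⟨SW.baseChange ℂ y, ?_, ?_⟩
    · change W.subtype.baseChange ℂ (SW.baseChange ℂ y) ∈ L
      have : W.subtype.baseChange ℂ (SW.baseChange ℂ y) =
          S.baseChange ℂ (W.subtype.baseChange ℂ y) := by
        apply complexification_ext <;> simp <;> rfl
      rw [this]
      exact hSL _ hy
    · apply complexification_ext <;> simp only [rePart_baseChange, imPart_baseChange, hΞ]
  have hβnd := reducedForm_nondegenerate hanti hnd hW hβ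
  refine ⟨Ξ, fun θ => ⟨SW θ, rfl, rfl⟩,
    map_eq_self_of_mapsTo (baseChange_injective (injective_of_preserves hβnd hΞβ)) hΞR, ?_⟩
  exact isStable_of_isPositive (isLagrangian_quotientImage hanti hnd hNW hW hβ hL hN)
    (isPositive_quotientImage hβ hD) hΞβ hΞR

end Reduction

/-! ### Local flows and their linearization in a normed space -/

section LocalFlow

variable {E : Type*} [NormedAddCommGroup E] [NormedSpace ℝ E]

/-- A vector field of class `C^1` has a local flow that stays in a given neighbourhood and is
Lipschitz in the initial point. -/
theorem exists_localFlow [CompleteSpace E] {X : E → E} {x₀ : E} (hX : ContDiffAt ℝ 1 X x₀)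
    {V : Set E} (hV : V ∈ 𝓝 x₀) :
    ∃ τ > 0, ∃ U ∈ 𝓝 x₀, ∃ α : E → ℝ → E, ∃ K : ℝ, 0 ≤ K ∧ (∀ x ∈ U, α x 0 = x) ∧
      (∀ x ∈ U, ∀ t, |t| < τ → HasDerivAt (α x) (X (α x t)) t) ∧
      (∀ x ∈ U, ∀ t, |t| < τ → α x t ∈ V) ∧
      ∀ x ∈ U, ∀ t, |t| < τ → ‖α x t - α x₀ t‖ ≤ K * ‖x - x₀‖ := by
  obtain ⟨ε, hε, a, r, L, K, hr, hpl⟩ := IsPicardLindelof.of_contDiffAt_one hX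
  obtain ⟨α, hα, K', hK'⟩ :=
    (hpl 0).exists_forall_mem_closedBall_eq_hasDerivWithinAt_lipschitzOnWith
  have hr' : (0 : ℝ) < r := hr
  have hderiv : ∀ x ∈ Metric.closedBall x₀ r, ∀ t, |t| < ε →
      HasDerivAt (α x) (X (α x t)) t := by
    intro x hx t ht
    rw [abs_lt] at ht
    exact ((hα x hx).2 t ⟨by linarith, by linarith⟩).hasDerivAt
      (Icc_mem_nhds (by linarith) (by linarith))
  have hlip : ∀ x ∈ Metric.closedBall x₀ r, ∀ t, |t| < ε →
      ‖α x t - α x₀ t‖ ≤ K' * ‖x - x₀‖ := by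
    intro x hx t ht
    rw [abs_lt] at ht
    have := (hK' t ⟨by linarith, by linarith⟩).dist_le_mul x hx x₀
      (Metric.mem_closedBall_self hr'.le)
    rwa [dist_eq_norm, dist_eq_norm] at this
  obtain ⟨δ, hδ, hδV⟩ := Metric.mem_nhds_iff.1 hV
  have hx₀ := Metric.mem_closedBall_self (x := x₀) hr'.le
  have hcont : ContinuousAt (α x₀) 0 := (hderiv x₀ hx₀ 0 (by simpa using hε)).continuousAt
  -- Half of `δ` is spent on the orbit of `x₀`, half on the Lipschitz deviation of its neighbours;
  -- the `+ 1` in the radius below covers a zero Lipschitz constant.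
  obtain ⟨τ, hτ, hτδ⟩ := Metric.continuousAt_iff.1 hcont (δ / 2) (by positivity)
  rw [(hα x₀ hx₀).1] at hτδ
  refine ⟨min τ ε, lt_min hτ hε, Metric.ball x₀ (min r (δ / (2 * (K' + 1)))),
    Metric.ball_mem_nhds _ (by positivity), α, K', K'.2, ?_, ?_, ?_, ?_⟩
  · intro x hx
    exact (hα x (Metric.ball_subset_closedBall
      (Metric.ball_subset_ball (min_le_left _ _) hx))).1
  · intro x hx t ht
    exact hderiv x (Metric.ball_subset_closedBall
      (Metric.ball_subset_ball (min_le_left _ _) hx)) t (ht.trans_le (min_le_right _ _))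
  · intro x hx t ht
    apply hδV
    have h1 := hlip x (Metric.ball_subset_closedBall
      (Metric.ball_subset_ball (min_le_left _ _) hx)) t (ht.trans_le (min_le_right _ _))
    have h2 : dist (α x₀ t) x₀ < δ / 2 := by
      apply hτδ
      rw [Real.dist_eq, sub_zero]
      exact ht.trans_le (min_le_left _ _)
    have h3 : ‖x - x₀‖ < δ / (2 * (K' + 1)) := by
      rw [← dist_eq_norm]
      exact (Metric.mem_ball.1 hx).trans_le (min_le_right _ _)
    rw [lt_div_iff₀ (by positivity)] at h3
    have h4 : (K' : ℝ) * ‖x - x₀‖ ≤ δ / 2 := by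
      nlinarith [norm_nonneg (x - x₀)]
    rw [Metric.mem_ball]
    calc dist (α x t) x₀ ≤ dist (α x t) (α x₀ t) + dist (α x₀ t) x₀ := dist_triangle _ _ _
      _ < δ := by rw [dist_eq_norm (α x t)]; linarith
  · intro x hx t ht
    exact hlip x (Metric.ball_subset_closedBall
      (Metric.ball_subset_ball (min_le_left _ _) hx)) t (ht.trans_le (min_le_right _ _))

/-- If the time `t` maps of a local flow are differentiable at a point, then their derivatives are
differentiable in `t` at `t = 0`, with the linearization of the vector field as derivative. -/
theorem hasDerivAt_fderiv_localFlow {X : E → E} {A : E →L[ℝ] E} {x₀ : E}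
    (hX : HasStrictFDerivAt X A x₀) {α : E → ℝ → E} {U : Set E} (hU : U ∈ 𝓝 x₀) {τ K : ℝ}
    (hτ : 0 < τ) (hK : 0 ≤ K) (h0 : ∀ x ∈ U, α x 0 = x)
    (hα : ∀ x ∈ U, ∀ t, |t| < τ → HasDerivAt (α x) (X (α x t)) t)
    (hlip : ∀ x ∈ U, ∀ t, |t| < τ → ‖α x t - α x₀ t‖ ≤ K * ‖x - x₀‖)
    {D : ℝ → E →L[ℝ] E} (hD : ∀ t, |t| < τ → HasFDerivAt (fun x => α x t) (D t) x₀) :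
    D 0 = ContinuousLinearMap.id ℝ E ∧ HasDerivAt D A 0 := by
  have hx₀ : x₀ ∈ U := mem_of_mem_nhds hU
  have hD0 : D 0 = ContinuousLinearMap.id ℝ E := by
    refine (hD 0 (by simpa using hτ)).unique ((hasFDerivAt_id x₀).congr_of_eventuallyEq ?_)
    filter_upwards [hU] with x hx
    rw [h0 x hx, id]
  refine ⟨hD0, ?_⟩
  rw [hasDerivAt_iff_isLittleO, Asymptotics.isLittleO_iff]
  intro c hc
  -- The final bound is `η * K + P * |t|`; `η` makes the first term at most `c / 2`, and the
  -- restriction on `t` below does the same for the second.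
  set η : ℝ := c / (2 * (K + 1)) with hη
  have hη0 : 0 < η := by positivity
  -- Strict differentiability is what is needed here: the field is compared at two moving points, `α
  -- x s` and `α x₀ s`.
  obtain ⟨V, hV, hVX⟩ := Filter.eventually_prod_self_iff'.1
    ((nhds_prod_eq (x := x₀) (y := x₀)) ▸ hX.isLittleO.def hη0)
  obtain ⟨δ, hδ, hδV⟩ := Metric.mem_nhds_iff.1 hV
  have hcont : ContinuousAt (α x₀) 0 := (hα x₀ hx₀ 0 (by simpa using hτ)).continuousAt
  obtain ⟨σ, hσ, hσδ⟩ := Metric.continuousAt_iff.1 hcont (δ / 2) (by positivity)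
  rw [h0 x₀ hx₀] at hσδ
  set P : ℝ := ‖A‖ * ((‖A‖ + η) * K) with hP
  have hP0 : 0 ≤ P := by positivity
  have hsmall : ∀ᶠ t : ℝ in 𝓝 0, |t| < min (min τ σ) (c / (2 * (P + 1))) := by
    have : (0 : ℝ) < min (min τ σ) (c / (2 * (P + 1))) := by positivity
    filter_upwards [Metric.ball_mem_nhds (0 : ℝ) this] with t ht
    simpa using ht
  filter_upwards [hsmall] with t ht
  rw [lt_min_iff, lt_min_iff] at ht
  obtain ⟨⟨htτ, htσ⟩, htc⟩ := ht
  rw [lt_div_iff₀ (by positivity)] at htc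
  have hC : η * K + P * |t| ≤ c := by
    have h1 : η * K ≤ c / 2 := by
      rw [hη, div_mul_eq_mul_div, div_le_div_iff₀ (by positivity) (by positivity)]
      nlinarith
    nlinarith [abs_nonneg t]
  have hC0 : 0 ≤ (η * K + P * |t|) * |t| := by positivity
  have hfd : HasFDerivAt (fun x => α x t - t • A x - x)
      (D t - t • A - ContinuousLinearMap.id ℝ E) x₀ :=
    ((hD t htτ).sub (A.hasFDerivAt.const_smul t)).sub (hasFDerivAt_id x₀)
  have hnear : ∀ᶠ x in 𝓝 x₀, x ∈ U ∧ K * ‖x - x₀‖ < δ / 2 := by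
    refine Filter.Eventually.and hU ?_
    have : ContinuousAt (fun x => K * ‖x - x₀‖) x₀ := by fun_prop
    exact Filter.Tendsto.eventually_lt_const (by simpa using hδ) this
  -- The operator norm of a derivative is controlled by a Lipschitz bound at `x₀` for the map, so no
  -- derivative in `x` has to be differentiated in `t`.
  have hle : ‖D t - t • A - ContinuousLinearMap.id ℝ E‖ ≤ (η * K + P * |t|) * |t| := by
    refine hfd.le_of_lip' hC0 ?_
    filter_upwards [hnear] with x hx
    obtain ⟨hxU, hxδ⟩ := hx
    set I : Set ℝ := Set.Icc (-|t|) |t| with hI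
    have hIt : ∀ s ∈ I, |s| ≤ |t| := fun s hs => abs_le.2 hs
    have hmem : ∀ s ∈ I, α x s ∈ V ∧ α x₀ s ∈ V := by
      intro s hs
      have h2 : dist (α x₀ s) x₀ < δ / 2 := by
        apply hσδ
        rw [Real.dist_eq, sub_zero]
        exact (hIt s hs).trans_lt htσ
      have h3 := hlip x hxU s ((hIt s hs).trans_lt htτ)
      refine ⟨hδV ?_, hδV ?_⟩
      · rw [Metric.mem_ball]
        calc dist (α x s) x₀ ≤ dist (α x s) (α x₀ s) + dist (α x₀ s) x₀ := dist_triangle _ _ _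
          _ < δ := by rw [dist_eq_norm (α x s)]; linarith
      · rw [Metric.mem_ball]
        linarith
    have hXV : ∀ s ∈ I, ‖X (α x s) - X (α x₀ s) - A (α x s - α x₀ s)‖ ≤
        η * (K * ‖x - x₀‖) := by
      intro s hs
      refine (hVX _ (hmem s hs).1 _ (hmem s hs).2).trans ?_
      exact mul_le_mul_of_nonneg_left (hlip x hxU s ((hIt s hs).trans_lt htτ)) hη0.le
    have hXL : ∀ s ∈ I, ‖X (α x s) - X (α x₀ s)‖ ≤ (‖A‖ + η) * K * ‖x - x₀‖ := by
      intro s hs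
      have h1 := hXV s hs
      have h2 : ‖A (α x s - α x₀ s)‖ ≤ ‖A‖ * (K * ‖x - x₀‖) := (A.le_opNorm _).trans
        (mul_le_mul_of_nonneg_left (hlip x hxU s ((hIt s hs).trans_lt htτ)) (norm_nonneg _))
      calc ‖X (α x s) - X (α x₀ s)‖
          = ‖(X (α x s) - X (α x₀ s) - A (α x s - α x₀ s)) + A (α x s - α x₀ s)‖ := by
            rw [sub_add_cancel]
        _ ≤ η * (K * ‖x - x₀‖) + ‖A‖ * (K * ‖x - x₀‖) := (norm_add_le _ _).trans (add_le_add h1 h2)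
        _ = _ := by ring
    have h0I : (0 : ℝ) ∈ I := ⟨by simp, by simp⟩
    have hd1 : ∀ s ∈ I, HasDerivAt (fun s => α x s - α x₀ s) (X (α x s) - X (α x₀ s)) s :=
      fun s hs => (hα x hxU s ((hIt s hs).trans_lt htτ)).sub
        (hα x₀ hx₀ s ((hIt s hs).trans_lt htτ))
    -- The mean value inequality is used twice: here the difference of orbits is constant up to
    -- `O(t)`, which put back into the equation gives the linear approximation with the required
    -- error.
    have hstep1 : ∀ s ∈ I, ‖α x s - α x₀ s - (x - x₀)‖ ≤
        (‖A‖ + η) * K * ‖x - x₀‖ * |t| := by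
      intro s hs
      have := (convex_Icc (-|t|) |t|).norm_image_sub_le_of_norm_hasDerivWithin_le
        (fun s hs => (hd1 s hs).hasDerivWithinAt) hXL h0I hs
      rw [h0 x hxU, h0 x₀ hx₀, sub_zero, Real.norm_eq_abs] at this
      exact this.trans (mul_le_mul_of_nonneg_left (hIt s hs) (by positivity))
    have hd2 : ∀ s ∈ I, HasDerivAt (fun s => α x s - α x₀ s - s • A (x - x₀))
        (X (α x s) - X (α x₀ s) - A (x - x₀)) s := fun s hs => by
      simpa only [id, one_smul] using!
        (hd1 s hs).sub ((hasDerivAt_id s).smul_const (A (x - x₀)))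
    have hb2 : ∀ s ∈ I, ‖X (α x s) - X (α x₀ s) - A (x - x₀)‖ ≤
        (η * K + P * |t|) * ‖x - x₀‖ := by
      intro s hs
      have h2 : ‖A (α x s - α x₀ s - (x - x₀))‖ ≤ ‖A‖ * ((‖A‖ + η) * K * ‖x - x₀‖ * |t|) :=
        (A.le_opNorm _).trans (mul_le_mul_of_nonneg_left (hstep1 s hs) (norm_nonneg _))
      calc ‖X (α x s) - X (α x₀ s) - A (x - x₀)‖
          = ‖(X (α x s) - X (α x₀ s) - A (α x s - α x₀ s)) + A (α x s - α x₀ s - (x - x₀))‖ := by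
            congr 1
            rw [map_sub A (α x s - α x₀ s)]
            abel
        _ ≤ η * (K * ‖x - x₀‖) + ‖A‖ * ((‖A‖ + η) * K * ‖x - x₀‖ * |t|) :=
            (norm_add_le _ _).trans (add_le_add (hXV s hs) h2)
        _ = _ := by rw [hP]; ring
    have htI : t ∈ I := ⟨neg_abs_le t, le_abs_self t⟩
    have := (convex_Icc (-|t|) |t|).norm_image_sub_le_of_norm_hasDerivWithin_le
      (fun s hs => (hd2 s hs).hasDerivWithinAt) hb2 h0I htI
    rw [h0 x hxU, h0 x₀ hx₀, sub_zero, Real.norm_eq_abs] at this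
    calc ‖α x t - t • A x - x - (α x₀ t - t • A x₀ - x₀)‖
        = ‖α x t - α x₀ t - t • A (x - x₀) - (x - x₀ - (0 : ℝ) • A (x - x₀))‖ := by
          congr 1
          rw [map_sub, smul_sub, zero_smul]
          abel
      _ ≤ (η * K + P * |t|) * ‖x - x₀‖ * |t| := this
      _ = _ := by ring
  calc ‖D t - D 0 - (t - 0) • A‖ = ‖D t - t • A - ContinuousLinearMap.id ℝ E‖ := by
        rw [hD0, sub_zero, sub_right_comm]
    _ ≤ (η * K + P * |t|) * |t| := hle
    _ ≤ c * ‖t - 0‖ := by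
        rw [sub_zero, Real.norm_eq_abs]
        exact mul_le_mul_of_nonneg_right hC (abs_nonneg _)

/-- The infinitesimal invariance of a closed 2-form under a Hamiltonian flow. -/
theorem hasDerivAt_form_localFlow {Ω : E → E →L[ℝ] E →L[ℝ] ℝ} {Ω' : E →L[ℝ] E →L[ℝ] E →L[ℝ] ℝ}
    {x₀ : E} (hΩ : HasFDerivAt Ω Ω' x₀) (hanti : ∀ᶠ y in 𝓝 x₀, ∀ u v, Ω y u v = -Ω y v u)
    (hclosed : ∀ u v w, Ω' u v w + Ω' v w u + Ω' w u v = 0)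
    {X : E → E} {A : E →L[ℝ] E} (hX : HasFDerivAt X A x₀)
    {θ : E → E →L[ℝ] ℝ} {H : E →L[ℝ] E →L[ℝ] ℝ} (hθ : HasFDerivAt θ H x₀)
    (hsymm : ∀ u v, H u v = H v u) (hham : ∀ᶠ y in 𝓝 x₀, ∀ u, Ω y u (X y) = θ y u)
    {c : ℝ → E} (hc0 : c 0 = x₀) (hc : HasDerivAt c (X x₀) 0)
    {D : ℝ → E →L[ℝ] E} (hD0 : D 0 = ContinuousLinearMap.id ℝ E) (hD : HasDerivAt D A 0)
    (v w : E) : HasDerivAt (fun t => Ω (c t) (D t v) (D t w)) 0 0 := by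
  have hanti' : ∀ y u v, Ω' y u v = -Ω' y v u := by
    intro y u v
    have h1 : HasFDerivAt (fun y => Ω y u v) ((Ω'.flip u).flip v) x₀ := by
      simpa using (hΩ.clm_apply (hasFDerivAt_const u x₀)).clm_apply (hasFDerivAt_const v x₀)
    have h2 : HasFDerivAt (fun y => -Ω y v u) (-(Ω'.flip v).flip u) x₀ := by
      refine HasFDerivAt.neg ?_
      simpa using (hΩ.clm_apply (hasFDerivAt_const v x₀)).clm_apply (hasFDerivAt_const u x₀)
    have h3 := h1.unique (h2.congr_of_eventuallyEq (hanti.mono fun y hy => hy u v))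
    simpa using DFunLike.congr_fun h3 y
  -- Hamilton's equation differentiated in the direction `z`.
  have hlin : ∀ u z, Ω' z u (X x₀) + Ω x₀ u (A z) = H z u := by
    intro u z
    have h1 : HasFDerivAt (fun y => Ω y u (X y))
        ((Ω x₀ u).comp A + (Ω'.flip u).flip (X x₀)) x₀ := by
      simpa using (hΩ.clm_apply (hasFDerivAt_const u x₀)).clm_apply hX
    have h2 : HasFDerivAt (fun y => θ y u) (H.flip u) x₀ := by
      simpa using hθ.clm_apply (hasFDerivAt_const u x₀)
    have h3 := h1.unique (h2.congr_of_eventuallyEq (hham.mono fun y hy => hy u))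
    have := DFunLike.congr_fun h3 z
    simp at this
    linarith
  have hΩc : HasDerivAt (fun t => Ω (c t)) (Ω' (X x₀)) 0 :=
    HasFDerivAt.comp_hasDerivAt (l := Ω) 0 (by rw [hc0]; exact hΩ) hc
  have hDv : ∀ z, HasDerivAt (fun t => D t z) (A z) 0 := fun z => by
    simpa using hD.clm_apply (hasDerivAt_const 0 z)
  have h := (hΩc.clm_apply (hDv v)).clm_apply (hDv w)
  refine h.congr_deriv ?_
  -- What remains is `Ω'(X)(v,w) + Ω(Av,w) + Ω(v,Aw) = 0`. Eliminating `A` by `hlin` cancels the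
  -- Hessians by symmetry and leaves the cyclic sum expressing closedness.
  simp only [hD0, hc0, ContinuousLinearMap.id_apply, add_apply]
  have e1 := hlin v w
  have e2 := hlin w v
  have e3 := hclosed (X x₀) v w
  have e4 := hanti' v w (X x₀)
  have e5 := hanti' w v (X x₀)
  have e6 := hanti.self_of_nhds (A v) w
  have e7 := hsymm v w
  linarith

end LocalFlow

/-! ### Vector fields and flows in a chart -/

section Charts

variable {E : Type*} [NormedAddCommGroup E] [NormedSpace ℝ E] {M : Type*} [TopologicalSpace M]
  [ChartedSpace E M]

/-- The derivative of the chart at `x₀`. -/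
def chartDeriv (x₀ m : M) : TangentSpace 𝓘(ℝ, E) m →L[ℝ] E :=
  mfderiv 𝓘(ℝ, E) 𝓘(ℝ, E) (extChartAt 𝓘(ℝ, E) x₀) m

/-- The derivative of the inverse of the chart at `x₀`. -/
def chartSymmDeriv (x₀ : M) (y : E) :
    E →L[ℝ] TangentSpace 𝓘(ℝ, E) ((extChartAt 𝓘(ℝ, E) x₀).symm y) :=
  mfderiv 𝓘(ℝ, E) 𝓘(ℝ, E) (extChartAt 𝓘(ℝ, E) x₀).symm y

/-- A vector field in the chart at `x₀`. -/
def chartField (X : ∀ m : M, TangentSpace 𝓘(ℝ, E) m) (x₀ : M) (y : E) : E :=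
  chartDeriv x₀ ((extChartAt 𝓘(ℝ, E) x₀).symm y) (X ((extChartAt 𝓘(ℝ, E) x₀).symm y))

/-- Lets a point be replaced by `symm y` through `rfl`, which avoids transporting tangent vectors
along an equality of base points. -/
theorem exists_eq_extChartAt_symm {x₀ m : M} (hm : m ∈ (extChartAt 𝓘(ℝ, E) x₀).source) :
    ∃ y ∈ (extChartAt 𝓘(ℝ, E) x₀).target, (extChartAt 𝓘(ℝ, E) x₀).symm y = m :=
  ⟨_, (extChartAt 𝓘(ℝ, E) x₀).map_source hm, (extChartAt 𝓘(ℝ, E) x₀).left_inv hm⟩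

theorem chartField_extChartAt (X : ∀ m : M, TangentSpace 𝓘(ℝ, E) m) {x₀ m : M}
    (hm : m ∈ (extChartAt 𝓘(ℝ, E) x₀).source) :
    chartField X x₀ (extChartAt 𝓘(ℝ, E) x₀ m) = chartDeriv x₀ m (X m) := by
  obtain ⟨y, hy, rfl⟩ := exists_eq_extChartAt_symm hm
  rw [(extChartAt 𝓘(ℝ, E) x₀).right_inv hy, chartField]

variable [IsManifold 𝓘(ℝ, E) ∞ M]

theorem chartDeriv_chartSymmDeriv {x₀ : M} {y : E} (hy : y ∈ (extChartAt 𝓘(ℝ, E) x₀).target)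
    (u : E) : chartDeriv x₀ ((extChartAt 𝓘(ℝ, E) x₀).symm y) (chartSymmDeriv x₀ y u) = u := by
  have h := mfderiv_extChartAt_comp_mfderivWithin_extChartAt_symm (I := 𝓘(ℝ, E)) hy
  rw [ModelWithCorners.range_eq_univ, mfderivWithin_univ] at h
  exact DFunLike.congr_fun h u

theorem chartSymmDeriv_chartDeriv {x₀ : M} {y : E} (hy : y ∈ (extChartAt 𝓘(ℝ, E) x₀).target)
    (v : TangentSpace 𝓘(ℝ, E) ((extChartAt 𝓘(ℝ, E) x₀).symm y)) :
    chartSymmDeriv x₀ y (chartDeriv x₀ ((extChartAt 𝓘(ℝ, E) x₀).symm y) v) = v := by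
  have h := mfderivWithin_extChartAt_symm_comp_mfderiv_extChartAt (I := 𝓘(ℝ, E)) hy
  rw [ModelWithCorners.range_eq_univ, mfderivWithin_univ] at h
  exact DFunLike.congr_fun h v

theorem hasMFDerivAt_extChartAt_chartDeriv {x₀ m : M}
    (hm : m ∈ (extChartAt 𝓘(ℝ, E) x₀).source) :
    HasMFDerivAt 𝓘(ℝ, E) 𝓘(ℝ, E) (extChartAt 𝓘(ℝ, E) x₀) m (chartDeriv x₀ m) := by
  rw [extChartAt_source] at hm
  exact (mdifferentiableAt_extChartAt hm).hasMFDerivAt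

theorem hasMFDerivAt_extChartAt_symm {x₀ : M} {y : E}
    (hy : y ∈ (extChartAt 𝓘(ℝ, E) x₀).target) :
    HasMFDerivAt 𝓘(ℝ, E) 𝓘(ℝ, E) (extChartAt 𝓘(ℝ, E) x₀).symm y (chartSymmDeriv x₀ y) := by
  have h := mdifferentiableWithinAt_extChartAt_symm (I := 𝓘(ℝ, E)) hy
  rw [ModelWithCorners.range_eq_univ, mdifferentiableWithinAt_univ] at h
  exact h.hasMFDerivAt

theorem hasDerivAt_extChartAt_comp {x₀ : M} {γ : ℝ → M} {t : ℝ}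
    {v : TangentSpace 𝓘(ℝ, E) (γ t)}
    (hγ : HasMFDerivAt 𝓘(ℝ, ℝ) 𝓘(ℝ, E) γ t ((1 : ℝ →L[ℝ] ℝ).smulRight v))
    (hs : γ t ∈ (extChartAt 𝓘(ℝ, E) x₀).source) :
    HasDerivAt (fun s => extChartAt 𝓘(ℝ, E) x₀ (γ s)) (chartDeriv x₀ (γ t) v) t := by
  have h := (hasMFDerivAt_extChartAt_chartDeriv hs).comp t hγ
  have h' : HasFDerivAt (fun s => extChartAt 𝓘(ℝ, E) x₀ (γ s))
      ((chartDeriv x₀ (γ t)).comp ((1 : ℝ →L[ℝ] ℝ).smulRight v) : ℝ →L[ℝ] E) t :=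
    hasMFDerivAt_iff_hasFDerivAt.1 h
  refine h'.hasDerivAt.congr_deriv ?_
  change chartDeriv x₀ (γ t) ((1 : ℝ) • v) = _
  rw [one_smul]

theorem hasMFDerivAt_extChartAt_symm_comp {x₀ : M} {c : ℝ → E} {t : ℝ} {v : E}
    (hc : HasDerivAt c v t) (hs : c t ∈ (extChartAt 𝓘(ℝ, E) x₀).target) :
    HasMFDerivAt 𝓘(ℝ, ℝ) 𝓘(ℝ, E) (fun s => (extChartAt 𝓘(ℝ, E) x₀).symm (c s)) t
      ((1 : ℝ →L[ℝ] ℝ).smulRight (chartSymmDeriv x₀ (c t) v)) := by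
  have h := (hasMFDerivAt_extChartAt_symm hs).comp t hc.hasFDerivAt.hasMFDerivAt
  refine h.congr_mfderiv ?_
  apply ContinuousLinearMap.ext_ring
  change chartSymmDeriv x₀ (c t) ((1 : ℝ) • v) = (1 : ℝ) • chartSymmDeriv x₀ (c t) v
  rw [one_smul, one_smul]

theorem hasFDerivAt_in_charts {x₀ : M} {f : M → M} {y : E}
    (hy : y ∈ (extChartAt 𝓘(ℝ, E) x₀).target)
    (hf : MDifferentiableAt 𝓘(ℝ, E) 𝓘(ℝ, E) f ((extChartAt 𝓘(ℝ, E) x₀).symm y))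
    (hs : f ((extChartAt 𝓘(ℝ, E) x₀).symm y) ∈ (extChartAt 𝓘(ℝ, E) x₀).source) :
    HasFDerivAt (fun z => extChartAt 𝓘(ℝ, E) x₀ (f ((extChartAt 𝓘(ℝ, E) x₀).symm z)))
      ((chartDeriv x₀ (f ((extChartAt 𝓘(ℝ, E) x₀).symm y))).comp
        ((mfderiv 𝓘(ℝ, E) 𝓘(ℝ, E) f ((extChartAt 𝓘(ℝ, E) x₀).symm y)).comp
          (chartSymmDeriv x₀ y))) y := by
  have h := (hasMFDerivAt_extChartAt_chartDeriv hs).comp y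
    (hf.hasMFDerivAt.comp y (hasMFDerivAt_extChartAt_symm hy))
  exact h.hasFDerivAt

/-- The trivialization of the tangent bundle at `x₀` is the derivative of the chart. The bundle form
of smoothness is what uniqueness of integral curves asks for. -/
theorem contMDiff_of_contDiffAt_chartField {X : ∀ m : M, TangentSpace 𝓘(ℝ, E) m}
    (hX : ∀ x₀, ContDiffAt ℝ 1 (chartField X x₀) (extChartAt 𝓘(ℝ, E) x₀ x₀)) :
    ContMDiff 𝓘(ℝ, E) 𝓘(ℝ, E).tangent 1
      (fun m => (⟨m, X m⟩ : TangentBundle 𝓘(ℝ, E) M)) := by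
  intro x₀
  refine (Bundle.contMDiffAt_section (E := TangentSpace 𝓘(ℝ, E)) (s := X) x₀).2 ?_
  have h := (hX x₀).contMDiffAt.comp x₀ (contMDiffAt_extChartAt (I := 𝓘(ℝ, E)) (x := x₀) (n := 1))
  refine h.congr_of_eventuallyEq ?_
  filter_upwards [extChartAt_source_mem_nhds (I := 𝓘(ℝ, E)) x₀] with m hm
  rw [Function.comp_apply, chartField_extChartAt X hm]
  rw [extChartAt_source] at hm
  rw [chartDeriv, ← TangentBundle.continuousLinearMapAt_trivializationAt hm]
  rw [Bundle.Trivialization.continuousLinearMapAt_apply,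
    Bundle.Trivialization.coe_linearMapAt_of_mem _ (by simpa using hm)]

/-- In a chart, a complete flow is given by a local flow of the vector field in the chart. -/
theorem exists_localFlow_in_chart [CompleteSpace E] [T2Space M]
    {X : ∀ m : M, TangentSpace 𝓘(ℝ, E) m}
    (hX : ∀ x₀, ContDiffOn ℝ 1 (chartField X x₀) (extChartAt 𝓘(ℝ, E) x₀).target)
    {g : ℝ → M → M} (hg0 : ∀ m, g 0 m = m) (hg : ∀ m, IsMIntegralCurve (fun t => g t m) X)
    {x₀ : M} {y₀ : E} (hy₀ : y₀ ∈ (extChartAt 𝓘(ℝ, E) x₀).target) :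
    ∃ τ > 0, ∃ U ∈ 𝓝 y₀, ∃ K : ℝ, 0 ≤ K ∧
      (∀ y ∈ U, y ∈ (extChartAt 𝓘(ℝ, E) x₀).target) ∧
      (∀ y ∈ U, ∀ t, |t| < τ →
        g t ((extChartAt 𝓘(ℝ, E) x₀).symm y) ∈ (extChartAt 𝓘(ℝ, E) x₀).source) ∧
      (∀ y ∈ U, ∀ t, |t| < τ →
        ‖extChartAt 𝓘(ℝ, E) x₀ (g t ((extChartAt 𝓘(ℝ, E) x₀).symm y)) -
          extChartAt 𝓘(ℝ, E) x₀ (g t ((extChartAt 𝓘(ℝ, E) x₀).symm y₀))‖ ≤ K * ‖y - y₀‖) := by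
  have htarget : (extChartAt 𝓘(ℝ, E) x₀).target ∈ 𝓝 y₀ :=
    (isOpen_extChartAt_target x₀).mem_nhds hy₀
  have hsec : ContMDiff 𝓘(ℝ, E) 𝓘(ℝ, E).tangent 1
      (fun m => (⟨m, X m⟩ : TangentBundle 𝓘(ℝ, E) M)) :=
    contMDiff_of_contDiffAt_chartField fun x =>
      (hX x).contDiffAt (extChartAt_target_mem_nhds x)
  obtain ⟨τ, hτ, U, hU, α, K, hK, hα0, hα, hαV, hαK⟩ :=
    exists_localFlow ((hX x₀).contDiffAt htarget) htarget
  -- Uniqueness of integral curves identifies `g` with the Picard–Lindelöf flow, whose estimates it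
  -- thereby inherits.
  have heq : ∀ y ∈ U, ∀ t, |t| < τ →
      g t ((extChartAt 𝓘(ℝ, E) x₀).symm y) = (extChartAt 𝓘(ℝ, E) x₀).symm (α y t) := by
    intro y hy t ht
    have hcurve : IsMIntegralCurveOn (fun s => (extChartAt 𝓘(ℝ, E) x₀).symm (α y s)) X
        (Set.Ioo (-τ) τ) := by
      intro s hs
      have hs' : |s| < τ := abs_lt.2 hs
      have h := hasMFDerivAt_extChartAt_symm_comp (hα y hy s hs') (hαV y hy s hs')
      rw [chartField, chartSymmDeriv_chartDeriv (hαV y hy s hs')] at h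
      exact h.hasMFDerivWithinAt
    refine isMIntegralCurveOn_Ioo_eqOn_of_contMDiff_boundaryless (t₀ := 0)
      (show (0 : ℝ) ∈ Set.Ioo (-τ) τ from ⟨by linarith, hτ⟩) hsec
      ((hg _).isMIntegralCurveOn _) hcurve ?_ (abs_lt.1 ht)
    simp only [hg0, hα0 y hy]
  refine ⟨τ, hτ, U ∩ (extChartAt 𝓘(ℝ, E) x₀).target, Filter.inter_mem hU htarget, K, hK,
    fun y hy => hy.2, fun y hy t ht => ?_, fun y hy t ht => ?_⟩
  · rw [heq y hy.1 t ht]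
    exact (extChartAt 𝓘(ℝ, E) x₀).map_target (hαV y hy.1 t ht)
  · rw [heq y hy.1 t ht, heq y₀ (mem_of_mem_nhds hU) t ht,
      (extChartAt 𝓘(ℝ, E) x₀).right_inv (hαV y hy.1 t ht),
      (extChartAt 𝓘(ℝ, E) x₀).right_inv (hαV y₀ (mem_of_mem_nhds hU) t ht)]
    exact hαK y hy.1 t ht

theorem flow_add [T2Space M] {X : ∀ m : M, TangentSpace 𝓘(ℝ, E) m}
    (hX : ContMDiff 𝓘(ℝ, E) 𝓘(ℝ, E).tangent 1
      (fun m => (⟨m, X m⟩ : TangentBundle 𝓘(ℝ, E) M)))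
    {g : ℝ → M → M} (hg0 : ∀ m, g 0 m = m) (hg : ∀ m, IsMIntegralCurve (fun t => g t m) X)
    (s t : ℝ) : g (s + t) = g s ∘ g t := by
  funext m
  have h := isMIntegralCurve_Ioo_eq_of_contMDiff_boundaryless (t₀ := 0) hX
    ((hg m).comp_add t) (hg (g t m)) (by simp [hg0])
  exact congrFun h s

end Charts

/-! ### Hamiltonian flows preserve the symplectic form -/

section HamiltonianFlow

variable {n : ℕ} {M : Type*} [TopologicalSpace M]
  [ChartedSpace (EuclideanSpace ℝ (Fin (2 * n))) M]

/-- The symplectic form in the chart at `x₀`. -/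
def chartForm (Ω : SymplecticForm n M) (x₀ : M) (y : EuclideanSpace ℝ (Fin (2 * n))) :
    EuclideanSpace ℝ (Fin (2 * n)) →L[ℝ] EuclideanSpace ℝ (Fin (2 * n)) →L[ℝ] ℝ :=
  LinearMap.toContinuousBilinearMap
    ((Ω.form ((extChartAt (𝓡 (2 * n)) x₀).symm y)).compl₁₂
      (chartSymmDeriv x₀ y).toLinearMap (chartSymmDeriv x₀ y).toLinearMap)

theorem chartForm_apply (Ω : SymplecticForm n M) (x₀ : M) (y u v : EuclideanSpace ℝ (Fin (2 * n))) :
    chartForm Ω x₀ y u v = Ω.form ((extChartAt (𝓡 (2 * n)) x₀).symm y)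
      (chartSymmDeriv x₀ y u) (chartSymmDeriv x₀ y v) := rfl

theorem chartForm_eq_formInChart (Ω : SymplecticForm n M) (x₀ : M)
    (u v : EuclideanSpace ℝ (Fin (2 * n))) :
    (fun y => chartForm Ω x₀ y u v) = formInChart Ω.form x₀ u v := rfl

theorem chartForm_antisymm (Ω : SymplecticForm n M) (x₀ : M)
    (y u v : EuclideanSpace ℝ (Fin (2 * n))) :
    chartForm Ω x₀ y u v = -chartForm Ω x₀ y v u := by
  rw [chartForm_apply, chartForm_apply, Ω.antisymm]

theorem contDiffOn_chartForm (Ω : SymplecticForm n M) (x₀ : M) :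
    ContDiffOn ℝ ∞ (chartForm Ω x₀) (extChartAt (𝓡 (2 * n)) x₀).target := by
  rw [contDiffOn_clm_apply]
  intro u
  rw [contDiffOn_clm_apply]
  intro v
  exact Ω.smooth x₀ u v

theorem fderiv_chartForm_closed (Ω : SymplecticForm n M) (x₀ : M)
    {y : EuclideanSpace ℝ (Fin (2 * n))} (hy : y ∈ (extChartAt (𝓡 (2 * n)) x₀).target)
    (u v w : EuclideanSpace ℝ (Fin (2 * n))) :
    fderiv ℝ (chartForm Ω x₀) y u v w + fderiv ℝ (chartForm Ω x₀) y v w u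
      + fderiv ℝ (chartForm Ω x₀) y w u v = 0 := by
  have hd : DifferentiableAt ℝ (chartForm Ω x₀) y :=
    ((contDiffOn_chartForm Ω x₀).contDiffAt
      ((isOpen_extChartAt_target x₀).mem_nhds hy)).differentiableAt (by simp)
  have h : ∀ a b c, fderiv ℝ (formInChart Ω.form x₀ b c) y a =
      fderiv ℝ (chartForm Ω x₀) y a b c := by
    intro a b c
    rw [← chartForm_eq_formInChart]
    have h1 := (hd.hasFDerivAt.clm_apply (hasFDerivAt_const b y)).clm_apply (hasFDerivAt_const c y)
    rw [h1.fderiv]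
    simp
  have := Ω.closed x₀ y hy u v w
  rwa [h, h, h] at this

variable [IsManifold (𝓡 (2 * n)) ∞ M]

theorem chartForm_chartDeriv (Ω : SymplecticForm n M) {x₀ m : M}
    (hm : m ∈ (extChartAt (𝓡 (2 * n)) x₀).source) (a b : TangentSpace (𝓡 (2 * n)) m) :
    chartForm Ω x₀ (extChartAt (𝓡 (2 * n)) x₀ m) (chartDeriv x₀ m a) (chartDeriv x₀ m b) =
      Ω.form m a b := by
  obtain ⟨y, hy, rfl⟩ := exists_eq_extChartAt_symm hm
  rw [(extChartAt (𝓡 (2 * n)) x₀).right_inv hy, chartForm_apply, chartSymmDeriv_chartDeriv hy,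
    chartSymmDeriv_chartDeriv hy]

theorem chartForm_chartField (Ω : SymplecticForm n M) {F : M → ℝ}
    (hF : ContMDiff (𝓡 (2 * n)) 𝓘(ℝ, ℝ) ∞ F) {x₀ : M} {y : EuclideanSpace ℝ (Fin (2 * n))}
    (hy : y ∈ (extChartAt (𝓡 (2 * n)) x₀).target) (u : EuclideanSpace ℝ (Fin (2 * n))) :
    chartForm Ω x₀ y u (chartField (hamiltonianField Ω F) x₀ y) =
      fderiv ℝ (fun z => F ((extChartAt (𝓡 (2 * n)) x₀).symm z)) y u := by
  rw [chartForm_apply, chartField, chartSymmDeriv_chartDeriv hy, hamiltonianField, Ω.form_J]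
  have h1 := (hF.mdifferentiable (by simp) ((extChartAt (𝓡 (2 * n)) x₀).symm y)).hasMFDerivAt
  obtain ⟨L, hL, hLu⟩ : ∃ L : EuclideanSpace ℝ (Fin (2 * n)) →L[ℝ] ℝ,
      HasFDerivAt (fun z => F ((extChartAt (𝓡 (2 * n)) x₀).symm z)) L y ∧
      ∀ u, L u = differential F _ (chartSymmDeriv x₀ y u) :=
    ⟨_, hasMFDerivAt_iff_hasFDerivAt.1 (h1.comp y (hasMFDerivAt_extChartAt_symm hy)),
      fun u => rfl⟩
  rw [hL.fderiv, hLu]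

theorem contDiffOn_comp_extChartAt_symm {F : M → ℝ}
    (hF : ContMDiff (𝓡 (2 * n)) 𝓘(ℝ, ℝ) ∞ F) (x₀ : M) :
    ContDiffOn ℝ ∞ (fun z => F ((extChartAt (𝓡 (2 * n)) x₀).symm z))
      (extChartAt (𝓡 (2 * n)) x₀).target :=
  (hF.comp_contMDiffOn (contMDiffOn_extChartAt_symm x₀)).contDiffOn

/-- In the chart the field is `B⁻¹ dF` with `B` the flipped form, and inversion of continuous linear
maps is smooth at invertible ones. -/
theorem contDiffOn_chartField (Ω : SymplecticForm n M) {F : M → ℝ}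
    (hF : ContMDiff (𝓡 (2 * n)) 𝓘(ℝ, ℝ) ∞ F) (x₀ : M) :
    ContDiffOn ℝ ∞ (chartField (hamiltonianField Ω F) x₀)
      (extChartAt (𝓡 (2 * n)) x₀).target := by
  have hopen := isOpen_extChartAt_target (I := 𝓡 (2 * n)) x₀
  set θ : EuclideanSpace ℝ (Fin (2 * n)) → EuclideanSpace ℝ (Fin (2 * n)) →L[ℝ] ℝ :=
    fderiv ℝ (fun z => F ((extChartAt (𝓡 (2 * n)) x₀).symm z)) with hθdef
  have hθ : ContDiffOn ℝ ∞ θ (extChartAt (𝓡 (2 * n)) x₀).target :=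
    (contDiffOn_comp_extChartAt_symm hF x₀).fderiv_of_isOpen hopen (by simp)
  set B : EuclideanSpace ℝ (Fin (2 * n)) → EuclideanSpace ℝ (Fin (2 * n)) →L[ℝ]
      (EuclideanSpace ℝ (Fin (2 * n)) →L[ℝ] ℝ) := fun y => (chartForm Ω x₀ y).flip with hBdef
  have hB : ContDiffOn ℝ ∞ B (extChartAt (𝓡 (2 * n)) x₀).target := by
    rw [hBdef, contDiffOn_clm_apply]
    intro u
    rw [contDiffOn_clm_apply]
    intro v
    exact Ω.smooth x₀ v u
  have hinj : ∀ y ∈ (extChartAt (𝓡 (2 * n)) x₀).target, (B y).ker = ⊥ := by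
    intro y hy
    rw [LinearMap.ker_eq_bot']
    intro x hx
    have h0 : chartSymmDeriv x₀ y x = 0 := by
      refine Ω.nondegenerate _ _ fun v => ?_
      have := DFunLike.congr_fun hx (chartDeriv x₀ _ v)
      change chartForm Ω x₀ y _ _ = 0 at this
      rwa [chartForm_apply, chartSymmDeriv_chartDeriv hy] at this
    rw [← chartDeriv_chartSymmDeriv hy x, h0, map_zero]
  have hsurj : ∀ y ∈ (extChartAt (𝓡 (2 * n)) x₀).target, (B y).range = ⊤ := by
    intro y hy
    rw [LinearMap.range_eq_top]
    intro a
    refine ⟨chartDeriv x₀ _ (Ω.J _ (a.comp (chartDeriv x₀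
      ((extChartAt (𝓡 (2 * n)) x₀).symm y))).toLinearMap), ?_⟩
    apply ContinuousLinearMap.ext
    intro u
    change chartForm Ω x₀ y u _ = a u
    rw [chartForm_apply, chartSymmDeriv_chartDeriv hy, Ω.form_J]
    change a (chartDeriv x₀ _ (chartSymmDeriv x₀ y u)) = a u
    rw [chartDeriv_chartSymmDeriv hy]
  have heq : ∀ y ∈ (extChartAt (𝓡 (2 * n)) x₀).target,
      chartField (hamiltonianField Ω F) x₀ y = (B y).inverse (θ y) := by
    intro y hy
    have h : B y (chartField (hamiltonianField Ω F) x₀ y) = θ y :=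
      ContinuousLinearMap.ext fun u => chartForm_chartField Ω hF hy u
    rw [← h, ← ContinuousLinearEquiv.coe_ofBijective (B y) (hinj y hy) (hsurj y hy),
      ContinuousLinearMap.inverse_equiv]
    simp
  refine ContDiffOn.congr (f := fun y => (B y).inverse (θ y)) ?_ heq
  intro y hy
  have hBy := (hB.contDiffAt (hopen.mem_nhds hy))
  have hθy := (hθ.contDiffAt (hopen.mem_nhds hy))
  have hinv : ContDiffAt ℝ ∞ ContinuousLinearMap.inverse (B y) := by
    have := contDiffAt_map_inverse (𝕜 := ℝ) (n := ∞)
      (ContinuousLinearEquiv.ofBijective (B y) (hinj y hy) (hsurj y hy))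
    rwa [ContinuousLinearEquiv.coe_ofBijective] at this
  exact ((hinv.comp y hBy).clm_apply hθy).contDiffWithinAt

/-- The pullback of the symplectic form. -/
def pullbackForm (Ω : SymplecticForm n M) (f : M → M) (m : M)
    (v w : TangentSpace (𝓡 (2 * n)) m) : ℝ :=
  Ω.form (f m) (mfderiv (𝓡 (2 * n)) (𝓡 (2 * n)) f m v) (mfderiv (𝓡 (2 * n)) (𝓡 (2 * n)) f m w)

omit [IsManifold (𝓡 (2 * n)) ∞ M] in
theorem pullbackForm_comp (Ω : SymplecticForm n M) {f h : M → M} {m : M}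
    (hf : MDifferentiableAt (𝓡 (2 * n)) (𝓡 (2 * n)) f (h m))
    (hh : MDifferentiableAt (𝓡 (2 * n)) (𝓡 (2 * n)) h m) (v w : TangentSpace (𝓡 (2 * n)) m) :
    pullbackForm Ω (f ∘ h) m v w = pullbackForm Ω f (h m)
      (mfderiv (𝓡 (2 * n)) (𝓡 (2 * n)) h m v) (mfderiv (𝓡 (2 * n)) (𝓡 (2 * n)) h m w) := by
  rw [pullbackForm, pullbackForm, mfderiv_comp m hf hh]
  rfl

theorem hasDerivAt_pullbackForm_in_chart [T2Space M] (Ω : SymplecticForm n M) {F : M → ℝ}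
    (hF : ContMDiff (𝓡 (2 * n)) 𝓘(ℝ, ℝ) ∞ F) {g : ℝ → M → M} (hg : IsHamiltonianFlow Ω F g)
    {x₀ : M} {y₀ : EuclideanSpace ℝ (Fin (2 * n))}
    (hy₀ : y₀ ∈ (extChartAt (𝓡 (2 * n)) x₀).target)
    (hd : ∀ t, MDifferentiableAt (𝓡 (2 * n)) (𝓡 (2 * n)) (g t)
      ((extChartAt (𝓡 (2 * n)) x₀).symm y₀))
    (v w : TangentSpace (𝓡 (2 * n)) ((extChartAt (𝓡 (2 * n)) x₀).symm y₀)) :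
    HasDerivAt (fun t => pullbackForm Ω (g t) ((extChartAt (𝓡 (2 * n)) x₀).symm y₀) v w) 0 0 := by
  have hopen := (isOpen_extChartAt_target (I := 𝓡 (2 * n)) x₀).mem_nhds hy₀
  have hX := contDiffOn_chartField Ω hF
  obtain ⟨τ, hτ, U, hU, K, hK, hUt, hUs, hlip⟩ := exists_localFlow_in_chart
    (fun x => (hX x).of_le (by simp)) (fun m => (hg m).1) (fun m => (hg m).2) hy₀
  have hy₀U := mem_of_mem_nhds hU
  set α : EuclideanSpace ℝ (Fin (2 * n)) → ℝ → EuclideanSpace ℝ (Fin (2 * n)) := fun y t =>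
    extChartAt (𝓡 (2 * n)) x₀ (g t ((extChartAt (𝓡 (2 * n)) x₀).symm y)) with hαdef
  have h0 : ∀ y ∈ U, α y 0 = y := fun y hy => by
    simp only [hαdef, (hg _).1]
    exact (extChartAt (𝓡 (2 * n)) x₀).right_inv (hUt y hy)
  have hα : ∀ y ∈ U, ∀ t, |t| < τ →
      HasDerivAt (α y) (chartField (hamiltonianField Ω F) x₀ (α y t)) t := by
    intro y hy t ht
    have h := hasDerivAt_extChartAt_comp ((hg ((extChartAt (𝓡 (2 * n)) x₀).symm y)).2 t)
      (hUs y hy t ht)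
    rwa [← chartField_extChartAt _ (hUs y hy t ht)] at h
  have hXat := (hX x₀).contDiffAt hopen
  have hXs := hXat.hasStrictFDerivAt (by simp)
  obtain ⟨hD0, hD⟩ := hasDerivAt_fderiv_localFlow hXs hU hτ hK h0 hα hlip
    (fun t ht => hasFDerivAt_in_charts hy₀ (hd t) (hUs y₀ hy₀U t ht))
  have hθ := (contDiffOn_comp_extChartAt_symm hF x₀).contDiffAt hopen
  have hθ' : DifferentiableAt ℝ
      (fderiv ℝ (fun z => F ((extChartAt (𝓡 (2 * n)) x₀).symm z))) y₀ :=
    (hθ.fderiv_right (m := ∞) (by simp)).differentiableAt (by simp)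
  have hc := hα y₀ hy₀U 0 (by simpa using hτ)
  rw [h0 y₀ hy₀U] at hc
  have hmain := hasDerivAt_form_localFlow (Ω := chartForm Ω x₀)
    (((contDiffOn_chartForm Ω x₀).contDiffAt hopen).differentiableAt (by simp)).hasFDerivAt
    (Filter.Eventually.of_forall fun y => chartForm_antisymm Ω x₀ y)
    (fderiv_chartForm_closed Ω x₀ hy₀) hXs.hasFDerivAt hθ'.hasFDerivAt
    (fun u v => (hθ.isSymmSndFDerivAt (by
      simpa using (ENat.LEInfty.out : (2 : ℕ∞ω) ≤ ∞))) u v)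
    (Filter.Eventually.mono hU fun y hy u => chartForm_chartField Ω hF (hUt y hy) u)
    (h0 y₀ hy₀U) hc hD0 hD (chartDeriv x₀ _ v) (chartDeriv x₀ _ w)
  refine hmain.congr_of_eventuallyEq ?_
  filter_upwards [Metric.ball_mem_nhds (0 : ℝ) hτ] with t ht
  have ht' : |t| < τ := by simpa using ht
  simp only [ContinuousLinearMap.comp_apply, hαdef, chartSymmDeriv_chartDeriv hy₀]
  rw [chartForm_chartDeriv Ω (hUs y₀ hy₀U t ht')]
  rfl

theorem hasDerivAt_pullbackForm_zero [T2Space M] (Ω : SymplecticForm n M) {F : M → ℝ}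
    (hF : ContMDiff (𝓡 (2 * n)) 𝓘(ℝ, ℝ) ∞ F) {g : ℝ → M → M} (hg : IsHamiltonianFlow Ω F g)
    {m : M} (hd : ∀ t, MDifferentiableAt (𝓡 (2 * n)) (𝓡 (2 * n)) (g t) m)
    (v w : TangentSpace (𝓡 (2 * n)) m) :
    HasDerivAt (fun t => pullbackForm Ω (g t) m v w) 0 0 := by
  -- The centre of the chart is kept independent of `m`, so that `m` can be substituted by `symm
  -- y₀`.
  have key : ∀ x₀ : M, m ∈ (extChartAt (𝓡 (2 * n)) x₀).source →
      HasDerivAt (fun t => pullbackForm Ω (g t) m v w) 0 0 := by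
    intro x₀ hx₀
    obtain ⟨y₀, hy₀, rfl⟩ := exists_eq_extChartAt_symm hx₀
    exact hasDerivAt_pullbackForm_in_chart Ω hF hg hy₀ hd v w
  exact key m (mem_extChartAt_source m)

/-- The time `t` maps of a Hamiltonian flow preserve the symplectic form along an orbit, as soon
as they are differentiable there. -/
theorem pullbackForm_flow [T2Space M] (Ω : SymplecticForm n M) {F : M → ℝ}
    (hF : ContMDiff (𝓡 (2 * n)) 𝓘(ℝ, ℝ) ∞ F) {g : ℝ → M → M} (hg : IsHamiltonianFlow Ω F g)
    {m : M} (hd : ∀ s t, MDifferentiableAt (𝓡 (2 * n)) (𝓡 (2 * n)) (g t) (g s m))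
    (t : ℝ) (v w : TangentSpace (𝓡 (2 * n)) m) :
    pullbackForm Ω (g t) m v w = Ω.form m v w := by
  have hd0 : ∀ t, MDifferentiableAt (𝓡 (2 * n)) (𝓡 (2 * n)) (g t) m := fun t => by
    simpa only [(hg m).1] using hd 0 t
  have hsec := contMDiff_of_contDiffAt_chartField (X := hamiltonianField Ω F) fun x =>
    ((contDiffOn_chartField Ω hF x).of_le (by simp)).contDiffAt (extChartAt_target_mem_nhds x)
  -- By the group law, the derivative at time `s` is the derivative at time `0` from the base point
  -- `g s m`, on the transported vectors.
  have hderiv : ∀ s, HasDerivAt (fun t => pullbackForm Ω (g t) m v w) 0 s := by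
    intro s
    have h := hasDerivAt_pullbackForm_zero Ω hF hg (hd s)
      (mfderiv (𝓡 (2 * n)) (𝓡 (2 * n)) (g s) m v) (mfderiv (𝓡 (2 * n)) (𝓡 (2 * n)) (g s) m w)
    simp only [← pullbackForm_comp Ω (hd s _) (hd0 s),
      ← flow_add hsec (fun m => (hg m).1) (fun m => (hg m).2)] at h
    have h' := HasDerivAt.comp_sub_const s s (f := fun t => pullbackForm Ω (g (t + s)) m v w)
      (by simpa using h)
    simpa using h'
  have hconst := is_const_of_deriv_eq_zero (fun s => (hderiv s).differentiableAt)
    (fun s => (hderiv s).deriv) t 0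
  have hid : g 0 = id := funext fun m => (hg m).1
  rw [hconst, hid, pullbackForm, mfderiv_id]
  rfl

end HamiltonianFlow

/-! ### Orbits in the torus are tangent to it -/

section Torus

/-- A differentiable curve in the image of an immersion that lifts continuously at one point has
there a velocity in the range of the derivative of the immersion. -/
theorem mem_range_of_lift {V E : Type*} [NormedAddCommGroup V] [NormedSpace ℝ V]
    [FiniteDimensional ℝ V] [NormedAddCommGroup E] [NormedSpace ℝ E] {P : V → E} {s : V}
    {A : V →L[ℝ] E} (hP : HasFDerivAt P A s) (hA : Function.Injective A) {c : ℝ → E} {v : E}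
    (hc : HasDerivAt c v 0) {σ : ℝ → V} (hσ : Filter.Tendsto σ (𝓝 0) (𝓝 s))
    (hPs : P s = c 0) (hPσ : ∀ t, P (σ t) = c t) : v ∈ LinearMap.range A.toLinearMap := by
  obtain ⟨K, hK0, hK⟩ := A.toLinearMap.exists_antilipschitzWith (LinearMap.ker_eq_bot.2 hA)
  have hK0' : (0 : ℝ) < K := hK0
  have hnorm : ∀ x : V, ‖x‖ ≤ K * ‖A x‖ := fun x => by
    simpa using hK.le_mul_norm_sub x 0
  have hlo := (hasFDerivAt_iff_isLittleO.1 hP).comp_tendsto hσ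
  -- The linearization error is taken below `1 / (2 * K)`, so that after applying the lower bound
  -- for `A` it is half of `‖σ t - s‖` and can be absorbed.
  have hO1 : (fun t => σ t - s) =O[𝓝 0] fun t => c t - c 0 := by
    refine Asymptotics.IsBigO.of_bound (2 * K) ?_
    filter_upwards [hlo.def (c := 1 / (2 * K)) (by positivity)] with t ht
    simp only [Function.comp_apply] at ht
    rw [hPσ, hPs] at ht
    have h1 := hnorm (σ t - s)
    have h2 : ‖A (σ t - s)‖ ≤ ‖c t - c 0‖ + 1 / (2 * K) * ‖σ t - s‖ := by
      calc ‖A (σ t - s)‖ = ‖(c t - c 0) - (c t - c 0 - A (σ t - s))‖ := by rw [sub_sub_cancel]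
        _ ≤ _ := (norm_sub_le _ _).trans (by gcongr)
    have h3 : (K : ℝ) * (1 / (2 * K) * ‖σ t - s‖) = ‖σ t - s‖ / 2 := by field_simp
    nlinarith
  have hO2 : (fun t => σ t - s) =O[𝓝 0] fun t : ℝ => t := by
    refine hO1.trans ?_
    simpa using hc.differentiableAt.isBigO_sub
  have hlo2 : (fun t => c t - c 0 - A (σ t - s)) =o[𝓝 0] fun t : ℝ => t := by
    refine (hlo.trans_isBigO hO2).congr_left fun t => ?_
    simp only [Function.comp_apply]
    rw [hPσ, hPs]
  have hlo3 : (fun t => c t - c 0 - t • v) =o[𝓝 0] fun t : ℝ => t := by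
    simpa using hasDerivAt_iff_isLittleO.1 hc
  have hlo4 : (fun t => A (σ t - s) - t • v) =o[𝓝 0] fun t : ℝ => t :=
    (hlo3.sub hlo2).congr_left fun t => by abel
  -- `v` is a limit of vectors in the range of `A`, which is closed; `σ` itself need not be
  -- differentiable.
  have hlim : Filter.Tendsto (fun t : ℝ => t⁻¹ • A (σ t - s)) (𝓝[≠] 0) (𝓝 v) := by
    have h := (hlo4.mono (nhdsWithin_le_nhds (s := {0}ᶜ))).tendsto_inv_smul_nhds_zero
    have h' : Filter.Tendsto (fun t : ℝ => t⁻¹ • (A (σ t - s) - t • v) + v) (𝓝[≠] 0)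
        (𝓝 (0 + v)) := h.add_const v
    rw [zero_add] at h'
    refine h'.congr' ?_
    filter_upwards [self_mem_nhdsWithin] with t ht
    rw [smul_sub, inv_smul_smul₀ ht, sub_add_cancel]
  exact (Submodule.closed_of_finiteDimensional (LinearMap.range A.toLinearMap)).mem_of_tendsto
    hlim (Filter.Eventually.of_forall fun t => Submodule.smul_mem _ _ ⟨_, rfl⟩)

theorem exists_circleExp_eq {k : ℕ} (s s' : Fin k → ℝ) :
    ∃ s'' ∈ Metric.closedBall s Real.pi, ∀ j, Circle.exp (s'' j) = Circle.exp (s' j) := by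
  refine ⟨fun j => toIocMod Real.two_pi_pos (s j - Real.pi) (s' j), ?_, fun j => ?_⟩
  · rw [Metric.mem_closedBall, dist_pi_le_iff Real.pi_pos.le]
    intro j
    have := toIocMod_mem_Ioc Real.two_pi_pos (s j - Real.pi) (s' j)
    rw [Real.dist_eq, abs_le]
    constructor <;> linarith [this.1, this.2]
  · rw [Circle.exp_eq_exp]
    refine ⟨-toIocDiv Real.two_pi_pos (s j - Real.pi) (s' j), ?_⟩
    have := toIocMod_add_toIocDiv_zsmul Real.two_pi_pos (s j - Real.pi) (s' j)
    rw [zsmul_eq_mul] at this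
    push_cast
    linarith

/-- Coordinates differ by multiples of `2π` but by at most `π`, so the centre is the only lift of
its image in the closed ball. -/
theorem eq_of_circleExp_eq {k : ℕ} {s s' : Fin k → ℝ} (hs : s' ∈ Metric.closedBall s Real.pi)
    (h : ∀ j, Circle.exp (s j) = Circle.exp (s' j)) : s' = s := by
  funext j
  obtain ⟨m, hm⟩ := Circle.exp_eq_exp.1 (h j)
  have hd := (dist_pi_le_iff Real.pi_pos.le).1 (Metric.mem_closedBall.1 hs) j
  rw [Real.dist_eq, abs_sub_comm, hm, add_sub_cancel_left, abs_mul,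
    abs_of_pos Real.two_pi_pos] at hd
  have hm0 : m = 0 := by
    by_contra hne
    have h1 : (1 : ℝ) ≤ |(m : ℝ)| := by exact_mod_cast Int.one_le_abs hne
    nlinarith [Real.pi_pos]
  simp [hm, hm0]

variable {n k : ℕ} {M : Type*} [TopologicalSpace M]
  [ChartedSpace (EuclideanSpace ℝ (Fin (2 * n))) M]

/-- Lifts are chosen in a compact ball around `s`. The image of the part of the ball outside a
neighbourhood of `s` is compact and misses `p s`, so nearby points of the curve lift into that
neighbourhood. -/
theorem exists_tendsto_lift [T2Space M] {p : (Fin k → ℝ) → M}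
    (hp : IsTorusParametrization (n := n) p) {s : Fin k → ℝ} {γ : ℝ → M}
    (hγ : ContinuousAt γ 0) (hγ0 : γ 0 = p s) (hγp : ∀ t, γ t ∈ Set.range p) :
    ∃ σ : ℝ → (Fin k → ℝ), (∀ t, p (σ t) = γ t) ∧ Filter.Tendsto σ (𝓝 0) (𝓝 s) := by
  have hex : ∀ t, ∃ s'' ∈ Metric.closedBall s Real.pi, p s'' = γ t := by
    intro t
    obtain ⟨s', hs'⟩ := hγp t
    obtain ⟨s'', h1, h2⟩ := exists_circleExp_eq s s'
    exact ⟨s'', h1, ((hp.eq_iff _ _).2 h2).trans hs'⟩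
  choose σ hσ hσp using hex
  refine ⟨σ, hσp, ?_⟩
  rw [tendsto_nhds]
  intro U hUo hsU
  have hcompact : IsCompact (p '' (Metric.closedBall s Real.pi \ U)) :=
    ((isCompact_closedBall s Real.pi).diff hUo).image hp.smooth.continuous
  have hnot : γ 0 ∉ p '' (Metric.closedBall s Real.pi \ U) := by
    rintro ⟨s', ⟨hs', hs'U⟩, h⟩
    rw [hγ0] at h
    rw [eq_of_circleExp_eq hs' ((hp.eq_iff _ _).1 h.symm)] at hs'U
    exact hs'U hsU
  filter_upwards [hγ.eventually (hcompact.isClosed.isOpen_compl.mem_nhds hnot)] with t ht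
  by_contra htU
  exact ht ⟨σ t, ⟨hσ t, htU⟩, hσp t⟩

variable [IsManifold (𝓡 (2 * n)) ∞ M]

theorem velocity_mem_torusTangent [T2Space M] {p : (Fin k → ℝ) → M}
    (hp : IsTorusParametrization (n := n) p) {s : Fin k → ℝ} {γ : ℝ → M}
    (hγ0 : γ 0 = p s) (hγp : ∀ t, γ t ∈ Set.range p) {X : ∀ m : M, TangentSpace (𝓡 (2 * n)) m}
    (hγ : IsMIntegralCurve γ X) : X (p s) ∈ torusTangent p s := by
  obtain ⟨σ, hσp, hσ⟩ := exists_tendsto_lift hp hγ.continuous.continuousAt hγ0 hγp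
  have hsource : p s ∈ (extChartAt (𝓡 (2 * n)) (p s)).source := mem_extChartAt_source _
  have hsourceγ : γ 0 ∈ (extChartAt (𝓡 (2 * n)) (p s)).source := hγ0 ▸ hsource
  have hc := hasDerivAt_extChartAt_comp (hγ 0) hsourceγ
  rw [← chartField_extChartAt X hsourceγ, hγ0, chartField_extChartAt X hsource] at hc
  have hps := (hp.smooth.mdifferentiable (by simp) s).hasMFDerivAt
  obtain ⟨A, hA, hAu⟩ : ∃ A : (Fin k → ℝ) →L[ℝ] EuclideanSpace ℝ (Fin (2 * n)),
      HasFDerivAt (fun z => extChartAt (𝓡 (2 * n)) (p s) (p z)) A s ∧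
      ∀ u, A u = chartDeriv (p s) (p s)
        (mfderiv 𝓘(ℝ, Fin k → ℝ) (𝓡 (2 * n)) p s u) :=
    ⟨_, hasMFDerivAt_iff_hasFDerivAt.1 ((hasMFDerivAt_extChartAt_chartDeriv hsource).comp s hps),
      fun u => rfl⟩
  have hinj : Function.Injective (chartDeriv (p s) (p s) :
      TangentSpace (𝓡 (2 * n)) (p s) →L[ℝ] EuclideanSpace ℝ (Fin (2 * n))) := by
    have key : ∀ x₀ m : M, m ∈ (extChartAt (𝓡 (2 * n)) x₀).source → Function.Injective
        (chartDeriv x₀ m : TangentSpace (𝓡 (2 * n)) m →L[ℝ] EuclideanSpace ℝ (Fin (2 * n))) := by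
      intro x₀ m hm
      obtain ⟨y, hy, rfl⟩ := exists_eq_extChartAt_symm hm
      exact Function.LeftInverse.injective (chartSymmDeriv_chartDeriv hy)
    exact key _ _ hsource
  have hAinj : Function.Injective A := fun u u' h => by
    rw [hAu, hAu] at h
    exact hp.immersion s (hinj h)
  obtain ⟨u, hu⟩ := mem_range_of_lift hA hAinj hc hσ (by simp only [hγ0])
    (fun t => by simp only [hσp])
  refine ⟨u, hinj ?_⟩
  rw [← hu]
  exact (hAu u).symm

end Torus

/-! ### Monodromy preserves the form and the germ -/

section Germ

variable {n k : ℕ} {M : Type*} [TopologicalSpace M]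
  [ChartedSpace (EuclideanSpace ℝ (Fin (2 * n))) M]

theorem finrank_tangentSpace (m : M) :
    Module.finrank ℝ (TangentSpace (𝓡 (2 * n)) m) = 2 * n :=
  finrank_euclideanSpace_fin (𝕜 := ℝ) (n := 2 * n)

theorem SymplecticForm.form_nondegenerate (Ω : SymplecticForm n M) (m : M) :
    (Ω.form m).Nondegenerate :=
  ⟨fun x hx => Ω.nondegenerate m x fun y => by rw [Ω.antisymm, hx, neg_zero],
    fun y hy => Ω.nondegenerate m y hy⟩

theorem mem_levelTangent_iff (F : Fin k → M → ℝ) (Ω : SymplecticForm n M) {m : M}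
    (x : TangentSpace (𝓡 (2 * n)) m) :
    x ∈ levelTangent F m ↔ ∀ j, Ω.form m x (hamiltonianField Ω (F j) m) = 0 := by
  simp only [levelTangent, Submodule.mem_iInf, LinearMap.mem_ker, hamiltonianField, Ω.form_J]

theorem finrank_torusTangent {p : (Fin k → ℝ) → M} (hp : IsTorusParametrization (n := n) p)
    (s : Fin k → ℝ) : Module.finrank ℝ (torusTangent (n := n) p s) = k := by
  have h : Module.finrank ℝ (TangentSpace 𝓘(ℝ, Fin k → ℝ) s) = k := Module.finrank_fin_fun ℝ
  rw [torusTangent, LinearMap.finrank_range_of_inj (hp.immersion s), h]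

/-- The `k` independent vectors `J dF_j` lie in the `k`-dimensional tangent space of the torus and
therefore span it. -/
theorem mem_levelTangent_iff_torusTangent (F : Fin k → M → ℝ) (Ω : SymplecticForm n M)
    {p : (Fin k → ℝ) → M} (hp : IsTorusParametrization (n := n) p) {s : Fin k → ℝ}
    (hindep : LinearIndependent ℝ fun j => differential (n := n) (F j) (p s))
    (hX : ∀ j, hamiltonianField Ω (F j) (p s) ∈ torusTangent p s)
    (x : TangentSpace (𝓡 (2 * n)) (p s)) :
    x ∈ levelTangent F (p s) ↔ ∀ u ∈ torusTangent p s, Ω.form (p s) x u = 0 := by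
  rw [mem_levelTangent_iff F Ω]
  refine ⟨fun h => ?_, fun h j => h _ (hX j)⟩
  have hli : LinearIndependent ℝ fun j => hamiltonianField Ω (F j) (p s) :=
    hindep.map' (Ω.J (p s)).toLinearMap (Ω.J (p s)).ker
  have hspan : Submodule.span ℝ (Set.range fun j => hamiltonianField Ω (F j) (p s)) =
      torusTangent p s := by
    refine Submodule.eq_of_le_of_finrank_eq
      (Submodule.span_le.2 (Set.range_subset_iff.2 hX)) ?_
    rw [finrank_span_eq_card hli, finrank_torusTangent hp, Fintype.card_fin]
  rw [← hspan]
  intro u hu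
  have hle : Submodule.span ℝ (Set.range fun j => hamiltonianField Ω (F j) (p s)) ≤
      LinearMap.ker (Ω.form (p s) x) := by
    refine Submodule.span_le.2 (Set.range_subset_iff.2 fun j => ?_)
    exact h j
  exact hle hu

/-- A map that preserves the torus, is differentiable there, and whose derivative preserves the
symplectic form and the germ. -/
structure PreservesGerm (Ω : SymplecticForm n M) (Λ : Set M)
    (r : ∀ m : M, Submodule ℂ (ℂ ⊗[ℝ] TangentSpace (𝓡 (2 * n)) m)) (f : M → M) : Prop where
  mapsTo : ∀ m ∈ Λ, f m ∈ Λ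
  differentiable : ∀ m ∈ Λ, MDifferentiableAt (𝓡 (2 * n)) (𝓡 (2 * n)) f m
  pullback : ∀ m ∈ Λ, ∀ v w, pullbackForm Ω f m v w = Ω.form m v w
  germ : ∀ m ∈ Λ, ∀ x ∈ r m, complexDerivative f m x ∈ r (f m)

variable {Ω : SymplecticForm n M} {Λ : Set M}
  {r : ∀ m : M, Submodule ℂ (ℂ ⊗[ℝ] TangentSpace (𝓡 (2 * n)) m)}

theorem PreservesGerm.id : PreservesGerm Ω Λ r id where
  mapsTo := fun m hm => hm
  differentiable := fun m _ => mdifferentiableAt_id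
  pullback := fun m _ v w => by rw [pullbackForm, mfderiv_id]; rfl
  germ := fun m _ x hx => by
    have : complexDerivative (n := n) (_root_.id : M → M) m = LinearMap.id := by
      rw [complexDerivative, mfderiv_id]
      exact LinearMap.baseChange_id
    rw [this]
    exact hx

theorem PreservesGerm.comp {f h : M → M} (hf : PreservesGerm Ω Λ r f)
    (hh : PreservesGerm Ω Λ r h) : PreservesGerm Ω Λ r (f ∘ h) where
  mapsTo := fun m hm => hf.mapsTo _ (hh.mapsTo m hm)
  differentiable := fun m hm =>
    (hf.differentiable _ (hh.mapsTo m hm)).comp m (hh.differentiable m hm)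
  pullback := fun m hm v w => by
    rw [pullbackForm_comp Ω (hf.differentiable _ (hh.mapsTo m hm)) (hh.differentiable m hm),
      hf.pullback _ (hh.mapsTo m hm)]
    exact hh.pullback m hm v w
  germ := fun m hm x hx => by
    have : complexDerivative (f ∘ h) m x =
        complexDerivative f (h m) (complexDerivative h m x) := by
      rw [complexDerivative, mfderiv_comp m (hf.differentiable _ (hh.mapsTo m hm))
        (hh.differentiable m hm)]
      exact LinearMap.congr_fun (LinearMap.baseChange_comp _ _) x
    rw [this]
    exact hf.germ _ (hh.mapsTo m hm) _ (hh.germ m hm x hx)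

theorem PreservesGerm.jointFlow {g : Fin k → ℝ → M → M}
    (hg : ∀ j t, PreservesGerm Ω Λ r (g j t)) (T : Fin k → ℝ) :
    PreservesGerm Ω Λ r (jointFlow g T) := by
  rw [ComplexGerm.jointFlow]
  have key : ∀ l : List (M → M), (∀ f ∈ l, PreservesGerm Ω Λ r f) →
      PreservesGerm Ω Λ r (l.foldr (fun f h => f ∘ h) _root_.id) := by
    intro l
    induction l with
    | nil => exact fun _ => PreservesGerm.id
    | cons f l ih =>
      intro hl
      exact (hl f (by simp)).comp (ih fun f' hf' => hl f' (by simp [hf']))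
  refine key _ fun f hf => ?_
  obtain ⟨j, rfl⟩ := (List.mem_ofFn' _ _).1 hf
  exact hg j (T j)

/-- The transport along `g^T m = m` hidden in `monodromy` disappears once the endpoint is
generalized to a variable. -/
theorem form_monodromy {g : Fin k → ℝ → M → M} {m : M} (T : periods g m)
    (v w : TangentSpace (𝓡 (2 * n)) m) :
    Ω.form m (monodromy g m T v) (monodromy g m T w) = pullbackForm Ω (jointFlow g T) m v w := by
  have key : ∀ (m' : M) (h : m' = m)
      (L : TangentSpace (𝓡 (2 * n)) m →L[ℝ] TangentSpace (𝓡 (2 * n)) m'),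
      Ω.form m ((h ▸ L : TangentSpace (𝓡 (2 * n)) m →L[ℝ] TangentSpace (𝓡 (2 * n)) m) v)
        ((h ▸ L : TangentSpace (𝓡 (2 * n)) m →L[ℝ] TangentSpace (𝓡 (2 * n)) m) w) =
      Ω.form m' (L v) (L w) := by
    rintro m' rfl L
    rfl
  exact key _ T.2 _

theorem baseChange_monodromy_mem {g : Fin k → ℝ → M → M} {m : M} (T : periods g m)
    {x : ℂ ⊗[ℝ] TangentSpace (𝓡 (2 * n)) m}
    (hx : complexDerivative (jointFlow g T) m x ∈ r (jointFlow g T m)) :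
    (monodromy g m T).baseChange ℂ x ∈ r m := by
  have key : ∀ (m' : M) (h : m' = m)
      (L : TangentSpace (𝓡 (2 * n)) m →L[ℝ] TangentSpace (𝓡 (2 * n)) m'),
      L.toLinearMap.baseChange ℂ x ∈ r m' →
      (h ▸ L : TangentSpace (𝓡 (2 * n)) m →L[ℝ]
        TangentSpace (𝓡 (2 * n)) m).toLinearMap.baseChange ℂ x ∈ r m := by
    rintro m' rfl L hL
    exact hL
  exact key _ T.2 _ hx

variable [IsManifold (𝓡 (2 * n)) ∞ M]

/-- The time `t` maps of a flow under which a germ is invariant are differentiable at the points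
of the torus: the derivative of a non-differentiable map would be zero by convention. -/
theorem IsComplexGerm.mdifferentiableAt (hn : 0 < n) {g : Fin k → ℝ → M → M}
    {p : (Fin k → ℝ) → M} (hr : IsComplexGerm Ω g p r)
    (hinv : ∀ j t, g j t '' Set.range p = Set.range p) (j : Fin k) (t : ℝ) (s : Fin k → ℝ) :
    MDifferentiableAt (𝓡 (2 * n)) (𝓡 (2 * n)) (g j t) (p s) := by
  by_contra hnd
  have h := hr.invariant j t s
  have h0 : complexDerivative (n := n) (g j t) (p s) = 0 := by
    rw [complexDerivative, mfderiv_zero_of_not_mdifferentiableAt hnd]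
    exact LinearMap.baseChange_zero
  -- The germ at the image point would be zero, while its complex dimension is `n > 0`.
  rw [h0, Submodule.map_zero] at h
  obtain ⟨s', hs'⟩ : g j t (p s) ∈ Set.range p := hinv j t ▸ ⟨p s, ⟨s, rfl⟩, rfl⟩
  rw [← hs'] at h
  have h2 := (hr.lagrangian s').2
  rw [← h, finrank_tangentSpace, finrank_bot] at h2
  omega

theorem IsComplexGerm.preservesGerm [T2Space M] (hn : 0 < n) {F : Fin k → M → ℝ}
    (hF : ∀ j, ContMDiff (𝓡 (2 * n)) 𝓘(ℝ, ℝ) ∞ (F j)) {g : Fin k → ℝ → M → M}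
    (hg : ∀ j, IsHamiltonianFlow Ω (F j) (g j)) {p : (Fin k → ℝ) → M}
    (hr : IsComplexGerm Ω g p r) (hinv : ∀ j t, g j t '' Set.range p = Set.range p)
    (j : Fin k) (t : ℝ) : PreservesGerm Ω (Set.range p) r (g j t) where
  mapsTo := fun m hm => hinv j t ▸ ⟨m, hm, rfl⟩
  differentiable := by
    rintro _ ⟨s, rfl⟩
    exact hr.mdifferentiableAt hn hinv j t s
  pullback := by
    intro m hm v w
    -- Differentiability is required along the whole orbit, which remains in the torus.
    refine pullbackForm_flow Ω (hF j) (hg j) (fun s t => ?_) t v w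
    obtain ⟨s', hs'⟩ : g j s m ∈ Set.range p := hinv j s ▸ ⟨m, hm, rfl⟩
    rw [← hs']
    exact hr.mdifferentiableAt hn hinv j t s'
  germ := by
    rintro _ ⟨s, rfl⟩ x hx
    rw [← hr.invariant j t s]
    exact Submodule.mem_map_of_mem hx

end Germ

end ComplexGerm

end

/-! ### The theorem -/

theorem mainTheorem2 {n k : ℕ} (hkn : k < n) {M : Type*} [TopologicalSpace M] [T2Space M]
    [ChartedSpace (EuclideanSpace ℝ (Fin (2 * n))) M] [IsManifold (𝓡 (2 * n)) ∞ M]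
    (Ω : ComplexGerm.SymplecticForm n M)
    (F : Fin k → M → ℝ) (hF : ∀ j, ContMDiff (𝓡 (2 * n)) 𝓘(ℝ, ℝ) ∞ (F j))
    (hinvol : ∀ i j m, ComplexGerm.poissonBracket Ω (F i) (F j) m = 0)
    (hindep : ∀ m, LinearIndependent ℝ
      fun j => ComplexGerm.differential (n := n) (F j) m)
    (g : Fin k → ℝ → M → M) (hg : ∀ j, ComplexGerm.IsHamiltonianFlow Ω (F j) (g j))
    (p : (Fin k → ℝ) → M) (hp : ComplexGerm.IsTorusParametrization (n := n) p)
    (hiso : ComplexGerm.IsIsotropicTorus Ω p)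
    (hinv : ∀ j t, g j t '' Set.range p = Set.range p)
    (r : ∀ m : M, Submodule ℂ (ℂ ⊗[ℝ] TangentSpace (𝓡 (2 * n)) m))
    (hr : ComplexGerm.IsComplexGerm Ω g p r) (s : Fin k → ℝ) :
    (∃ β : LinearMap.BilinForm ℝ (ComplexGerm.reducedSpace (n := n) F p s),
      ComplexGerm.IsReducedForm Ω F p s β ∧ β.Nondegenerate ∧
      ComplexGerm.IsLagrangian β (ComplexGerm.reducedSubspace F p s (r (p s))) ∧
      ComplexGerm.IsPositive β (ComplexGerm.reducedSubspace F p s (r (p s)))) ∧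
    ∀ T : ComplexGerm.periods g (p s),
      ∃ Ξ : ComplexGerm.reducedSpace (n := n) F p s →ₗ[ℝ]
          ComplexGerm.reducedSpace (n := n) F p s,
        ComplexGerm.IsReducedMonodromy F g p s T Ξ ∧
        (ComplexGerm.reducedSubspace F p s (r (p s))).map (Ξ.baseChange ℂ) =
          ComplexGerm.reducedSubspace F p s (r (p s)) ∧
        ComplexGerm.IsStable Ξ ∧ ComplexGerm.IsStable (Ξ.baseChange ℂ) := by
  open ComplexGerm in
  have hX : ∀ j, hamiltonianField Ω (F j) (p s) ∈ torusTangent p s := fun j =>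
    velocity_mem_torusTangent hp (γ := fun t => g j t (p s)) (hg j (p s)).1
      (fun t => hinv j t ▸ ⟨p s, ⟨s, rfl⟩, rfl⟩) (hg j (p s)).2
  have hW := ComplexGerm.mem_levelTangent_iff_torusTangent F Ω hp (hindep (p s)) hX
  have hNW : ComplexGerm.torusTangent (n := n) p s ≤ ComplexGerm.levelTangent F (p s) :=
    fun u hu => (hW u).2 fun v hv => hiso s u hu v hv
  have hanti := Ω.antisymm (p s)
  have hnd := Ω.form_nondegenerate (p s)
  -- `reduction` and `reducedSubspace` unfold to `mkQ` and `quotientImage` for these `N` and `W`, so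
  -- the linear lemmas apply definitionally.
  obtain ⟨β, hβ⟩ := ComplexGerm.exists_reducedForm hanti hW
  refine ⟨⟨β, hβ, ComplexGerm.reducedForm_nondegenerate hanti hnd hW hβ,
    ComplexGerm.isLagrangian_quotientImage hanti hnd hNW hW hβ (hr.lagrangian s) (hr.contains s),
    ComplexGerm.isPositive_quotientImage hβ (hr.dissipative s)⟩, fun T => ?_⟩
  have hT := ComplexGerm.PreservesGerm.jointFlow
    (hr.preservesGerm (Nat.zero_lt_of_lt hkn) hF hg hinv) (T : Fin k → ℝ)
  exact ComplexGerm.exists_reduced_operator hanti hnd hNW hW hβ (hr.lagrangian s)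
    (hr.contains s) (hr.dissipative s)
    (fun v w => by rw [ComplexGerm.form_monodromy, hT.pullback _ ⟨s, rfl⟩])
    (fun x hx => ComplexGerm.baseChange_monodromy_mem T (hT.germ _ ⟨s, rfl⟩ x hx))
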